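/- Let $n\ge 3$ be an odd integer, and let $M$ be a compact connected orientable smooth $n$-manifold with boundary $\partial M$, equipped with a volume form $\omega$ (by which we orient $M$). Let $\Omega^l(M,\partial M)$ be the space of smooth $l$-forms on $M$ whose pullback to $\partial M$ is zero, and assume that the cohomology of the complex $(\Omega^*(M,\partial M),d)$, that is $H^l(M,\partial M)$, is zero for all $l<n$. Let $G=\mathrm{Diff}_{\omega,0}(M,\partial M)$ be the identity component (in the $C^\infty$ topology) of the group of those elements of the identity component of the group of $\omega$-preserving $C^\infty$-diffeomorphisms of $M$ which fix $\partial M$ pointwise. For $k,l\ge 0$ let $\mathscr A^{k,l}$ be the set of maps $c\colon G^k\to\Omega^l(M)$, and let $$\delta c(g_1,\dots,g_{k+1})=c(g_2,\dots,g_{k+1})+\sum_{i=1}^{k}(-1)^i c(g_1,\dots,g_ig_{i+1},\dots,g_{k+1})+(-1)^{k+1}c(g_1,\dots,g_k)^{g_{k+1}},$$ where $\alpha^{g}=g^*\alpha$, let $d''=(-1)^k d$ on $\mathscr A^{k,l}$, and let $d=\delta+d''$ be the differential of the total complex $\mathscr A^m=\bigoplus_{k+l=m}\mathscr A^{k,l}$.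 For $\alpha\in\mathscr A^{p,q}$, $\beta\in\mathscr A^{r,s}$ put $$(\alpha\wedge\beta)(g_1,\dots,g_{p+r})=\alpha(g_1,\dots,g_p)^{g_{p+1}\cdots g_{p+r}}\wedge\beta(g_{p+1},\dots,g_{p+r}),$$ extended bilinearly to the total complex. Let $\omega^{(n)}\in\mathscr A^{0,n}=\Omega^n(M)$ be the element $\omega$. The cohomology $H^*(BG^\delta;\mathbb R)$ is that of the complex of maps $G^k\to\mathbb R$, with $\delta$ given by the same formula (with trivial action), and $\int_M$ maps an element of the total complex to the cochains obtained by integrating its components in $\mathscr A^{k,n}$ over $M$. Let $\phi=\phi^{(0)}+\dots+\phi^{(n-1)}\in\mathscr A^{n-1}$, $\phi^{(l)}\in\mathscr A^{n-1-l,l}$, be any element such that $d\phi=\omega^{(n)}$ and such that $\phi^{(l)}$ has values in $\Omega^l(M,\partial M)$ for all $0\le l\le n-2$. Then $\int_M\phi^{(0)}\wedge\omega^{(n)}$ is a cocycle, and the class which it represents, $$c(M)=\Big[\int_M\phi^{(0)}\wedge\omega^{(n)}\Big]\in H^{n-1}(BG^\delta;\mathbb R),$$ is zero. More precisely, $$\int_M\phi^{(0)}\wedge\omega^{(n)}=\delta\Big(\tfrac12\int_M\phi\wedge\phi\Big).$$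 -/

import Mathlib

open scoped Manifold ContDiff Topology

noncomputable section

namespace VolumeDiff

/-! ### Differential forms on a manifold with boundary -/

section Forms

/-- The Euclidean space on whose half-space `n`-dimensional manifolds with boundary are modelled. -/
abbrev Eucl (n : ℕ) : Type := EuclideanSpace ℝ (Fin n)

variable (n : ℕ) [NeZero n] (M : Type*) [TopologicalSpace M]
  [ChartedSpace (EuclideanHalfSpace n) M]

/-- Fields of alternating `l`-linear forms on the tangent spaces of `M`
(no regularity; see `IsSmooth`). -/
abbrev DForm (l : ℕ) : Type _ :=
  (x : M) → (TangentSpace (𝓡∂ n) x) [⋀^Fin l]→L[ℝ] ℝ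

variable {n M} {l : ℕ}

/-- The coordinate expression of a form in the preferred chart at `x₀`, i.e. its pullback under
the inverse of the chart. It is meaningful on the target of the chart. -/
def chartRep (α : DForm n M l) (x₀ : M) : Eucl n → (Eucl n) [⋀^Fin l]→L[ℝ] ℝ := fun y =>
  (α ((extChartAt (𝓡∂ n) x₀).symm y)).compContinuousLinearMap
    (mfderivWithin 𝓘(ℝ, Eucl n) (𝓡∂ n) (extChartAt (𝓡∂ n) x₀).symm (Set.range (𝓡∂ n)) y :
      Eucl n →L[ℝ] TangentSpace (𝓡∂ n) ((extChartAt (𝓡∂ n) x₀).symm y))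

/-- Smoothness of a form (up to the boundary): all coordinate expressions are `C^∞`. -/
def IsSmooth (α : DForm n M l) : Prop :=
  ∀ x₀ : M, ContDiffOn ℝ ∞ (chartRep α x₀) (extChartAt (𝓡∂ n) x₀).target

/-- The exterior derivative: at `x`, take the exterior derivative of the coordinate expression in
the chart at `x`, and pull it back under the chart. -/
def dForm (α : DForm n M l) : DForm n M (l + 1) := fun x =>
  (extDerivWithin (chartRep α x) (Set.range (𝓡∂ n))
      (extChartAt (𝓡∂ n) x x)).compContinuousLinearMap
    (mfderiv (𝓡∂ n) 𝓘(ℝ, Eucl n) (extChartAt (𝓡∂ n) x) x : TangentSpace (𝓡∂ n) x →L[ℝ] Eucl n)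

/-- The pullback `f^* α`. -/
def pullback (f : M → M) (α : DForm n M l) : DForm n M l := fun x =>
  (α (f x)).compContinuousLinearMap (mfderiv (𝓡∂ n) (𝓡∂ n) f x)

/-- A tangent vector at a boundary point is tangent to the boundary when the coordinate
transverse to the boundary of the half-space vanishes. -/
def TangentToBoundary (x : M) (v : TangentSpace (𝓡∂ n) x) : Prop :=
  let u : Eucl n := mfderiv (𝓡∂ n) 𝓘(ℝ, Eucl n) (extChartAt (𝓡∂ n) x) x v
  u 0 = 0

/-- The pullback of `α` to `∂M` is zero. -/
def VanishesOnBoundary (α : DForm n M l) : Prop :=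
  ∀ x ∈ (𝓡∂ n).boundary M, ∀ v : Fin l → TangentSpace (𝓡∂ n) x,
    (∀ i, TangentToBoundary x (v i)) → α x v = 0

/-- Membership in `Ω^l(M, ∂M)`: smooth forms whose pullback to `∂M` is zero. -/
def IsRelForm (α : DForm n M l) : Prop := IsSmooth α ∧ VanishesOnBoundary α

variable (n M) in
/-- `H^l(M, ∂M) = 0`, in terms of the complex `Ω^*(M, ∂M)`: every cocycle of degree `l` is
a coboundary (for `l = 0`, every cocycle is zero). -/
def RelCohomologyVanishes : ℕ → Prop
  | 0 => ∀ α : DForm n M 0, IsRelForm α → dForm α = 0 → α = 0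
  | l + 1 => ∀ α : DForm n M (l + 1), IsRelForm α → dForm α = 0 →
      ∃ β : DForm n M l, IsRelForm β ∧ dForm β = α

/-- A volume form: a smooth nowhere vanishing form of top degree. It also orients `M`. -/
def IsVolumeForm (vol : DForm n M n) : Prop := IsSmooth vol ∧ ∀ x, vol x ≠ 0

end Forms

/-! ### Wedge product of alternating forms -/

section Wedge

variable {V : Type*} [AddCommGroup V] [Module ℝ V] [TopologicalSpace V]

/-- The multilinear map `v ↦ α (v_1, …, v_q) * β (v_{q+1}, …, v_{q+s})`. -/
def tensorForm {q s : ℕ} (α : V [⋀^Fin q]→L[ℝ] ℝ) (β : V [⋀^Fin s]→L[ℝ] ℝ) :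
    ContinuousMultilinearMap ℝ (fun _ : Fin (q + s) => V) ℝ where
  toMultilinearMap := ((LinearMap.mul' ℝ ℝ).compMultilinearMap
    (MultilinearMap.domCoprod α.toMultilinearMap β.toMultilinearMap)).domDomCongr finSumFinEquiv
  cont := by
    have h1 : Continuous fun v : Fin (q + s) → V => α (fun i => v (Fin.castAdd s i)) :=
      α.cont.comp (by fun_prop)
    have h2 : Continuous fun v : Fin (q + s) → V => β (fun i => v (Fin.natAdd q i)) :=
      β.cont.comp (by fun_prop)
    refine (h1.mul h2).congr fun v => ?_
    simp [MultilinearMap.domCoprod_apply]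

theorem tensorForm_apply {q s : ℕ} (α : V [⋀^Fin q]→L[ℝ] ℝ) (β : V [⋀^Fin s]→L[ℝ] ℝ)
    (v : Fin (q + s) → V) :
    tensorForm α β v =
      α (fun i => v (Fin.castAdd s i)) * β (fun i => v (Fin.natAdd q i)) := by
  change ((LinearMap.mul' ℝ ℝ).compMultilinearMap
    (MultilinearMap.domCoprod α.toMultilinearMap β.toMultilinearMap)).domDomCongr finSumFinEquiv v
    = _
  simp [MultilinearMap.domCoprod_apply]

/-- Transport of an alternating form along an equality of degrees. -/
def castDegree {q l : ℕ} (h : q = l) (α : V [⋀^Fin q]→L[ℝ] ℝ) : V [⋀^Fin l]→L[ℝ] ℝ := h ▸ α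

/-- The wedge product of a `q`-form and an `s`-form, as a form of degree `l = q + s`:
`(α ∧ β)(v) = 1/(q! s!) ∑_σ sign σ · α (v_{σ 1}, …, v_{σ q}) β (v_{σ (q+1)}, …, v_{σ (q+s)})`. -/
def wedge {q s l : ℕ} (h : q + s = l) (α : V [⋀^Fin q]→L[ℝ] ℝ) (β : V [⋀^Fin s]→L[ℝ] ℝ) :
    V [⋀^Fin l]→L[ℝ] ℝ :=
  castDegree h (((1 : ℝ) / (q.factorial * s.factorial)) •
    ContinuousMultilinearMap.alternatization (tensorForm α β))

end Wedge

/-! ### Integration -/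

section Integration

variable {n : ℕ} [NeZero n] {M : Type*} [TopologicalSpace M] [ChartedSpace (EuclideanHalfSpace n) M]

/-- The coefficient of `dy_1 ∧ ⋯ ∧ dy_n` in the coordinate expression of an `n`-form. -/
def coeff (α : DForm n M n) (x₀ : M) (y : Eucl n) : ℝ :=
  chartRep α x₀ y (fun j => EuclideanSpace.single j (1 : ℝ))

variable (n M) in
/-- Some smooth partition of unity subordinate to the chart domains of `M`. -/
def chartPartition [T2Space M] [CompactSpace M] [IsManifold (𝓡∂ n) ∞ M] :
    SmoothPartitionOfUnity M (𝓡∂ n) M Set.univ :=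
  (SmoothPartitionOfUnity.exists_isSubordinate_chartAt_source (𝓡∂ n) M).choose

/-- The integral `∫_M α` of an `n`-form over the compact manifold `M` oriented by the volume form
`ω`: by a partition of unity, integrate coordinate expressions against Lebesgue measure, with a
minus sign in charts (more precisely, at those points of charts) where the chart reverses the
orientation. It does not depend on the partition of unity. -/
def integral [T2Space M] [CompactSpace M] [IsManifold (𝓡∂ n) ∞ M] (vol α : DForm n M n) : ℝ :=
  ∑ᶠ i : M, ∫ y in (extChartAt (𝓡∂ n) i).target,
    chartPartition n M i ((extChartAt (𝓡∂ n) i).symm y) *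
      (Real.sign (coeff vol i y) * coeff α i y)

end Integration

/-! ### Groups of diffeomorphisms -/

section Diffeos

variable (n : ℕ) [NeZero n] (M : Type*) [TopologicalSpace M]
  [ChartedSpace (EuclideanHalfSpace n) M]

/-- The group `Diff(M)` of `C^∞`-diffeomorphisms of `M`; the product is the composition. -/
def DiffGroup : Subgroup (Equiv.Perm M) where
  carrier := {g | ContMDiff (𝓡∂ n) (𝓡∂ n) ∞ g ∧ ContMDiff (𝓡∂ n) (𝓡∂ n) ∞ g.symm}
  mul_mem' := fun ha hb => ⟨ha.1.comp hb.1, hb.2.comp ha.2⟩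
  one_mem' := ⟨contMDiff_id, contMDiff_id⟩
  inv_mem' := fun h => ⟨h.2, h.1⟩

variable {n M}

/-- The underlying map of a diffeomorphism. -/
def toMap (g : DiffGroup n M) : M → M := (g : Equiv.Perm M)

/-- A map of `M` read in the charts `e` of the source and `e'` of the target. -/
def inCharts (e e' : OpenPartialHomeomorph M (EuclideanHalfSpace n)) (f : M → M) :
    Eucl n → Eucl n :=
  fun y => e'.extend (𝓡∂ n) (f ((e.extend (𝓡∂ n)).symm y))

variable (n M) in
/-- The `C^∞` topology on `Diff(M)`: a subbasis is given by the sets of all `g` which, on a compact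
set `K` contained in the domain of a chart `e`, and read in charts `e`, `e'`, are `ε`-close to
a given `f`, together with all derivatives of order at most `r`. -/
@[reducible] def smoothTopology : TopologicalSpace (DiffGroup n M) :=
  TopologicalSpace.generateFrom
    {U | ∃ (f : DiffGroup n M), ∃ e ∈ IsManifold.maximalAtlas (𝓡∂ n) ∞ M,
      ∃ e' ∈ IsManifold.maximalAtlas (𝓡∂ n) ∞ M, ∃ (K : Set M) (r : ℕ) (ε : ℝ),
        IsCompact K ∧ K ⊆ e.source ∧ Set.MapsTo (toMap f) K e'.source ∧ 0 < ε ∧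
        U = {g | Set.MapsTo (toMap g) K e'.source ∧ ∀ k ≤ r, ∀ x ∈ K,
          ‖iteratedFDerivWithin ℝ k (inCharts e e' (toMap f)) (Set.range (𝓡∂ n))
              (e.extend (𝓡∂ n) x) -
            iteratedFDerivWithin ℝ k (inCharts e e' (toMap g)) (Set.range (𝓡∂ n))
              (e.extend (𝓡∂ n) x)‖ < ε}}

/-- The identity component of a group `H` of diffeomorphisms, in the `C^∞` topology. (For compact
`M` the connected component of the identity is already a subgroup; the closure only provides
the structure of a subgroup.) -/
def identityComponent (H : Subgroup (DiffGroup n M)) : Subgroup (DiffGroup n M) :=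
  Subgroup.closure (@connectedComponentIn (DiffGroup n M) (smoothTopology n M) (H : Set _) 1)

theorem pullback_one {l : ℕ} (α : DForm n M l) :
    pullback (toMap (1 : DiffGroup n M)) α = α := by
  funext x
  have h : mfderiv (𝓡∂ n) (𝓡∂ n) (toMap (1 : DiffGroup n M)) x =
    ContinuousLinearMap.id ℝ (TangentSpace (𝓡∂ n) x) := mfderiv_id
  unfold pullback
  rw [h]
  rfl

theorem pullback_mul {l : ℕ} (g h : DiffGroup n M) (α : DForm n M l) :
    pullback (toMap (g * h)) α = pullback (toMap h) (pullback (toMap g) α) := by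
  funext x
  have hg : MDifferentiableAt (𝓡∂ n) (𝓡∂ n) (toMap g) ((toMap h) x) :=
    (g.2.1 _).mdifferentiableAt (by simp)
  have hh : MDifferentiableAt (𝓡∂ n) (𝓡∂ n) (toMap h) x :=
    (h.2.1 _).mdifferentiableAt (by simp)
  have hc : mfderiv (𝓡∂ n) (𝓡∂ n) (toMap (g * h)) x =
      (mfderiv (𝓡∂ n) (𝓡∂ n) (toMap g) ((toMap h) x)).comp (mfderiv (𝓡∂ n) (𝓡∂ n) (toMap h) x) :=
    mfderiv_comp x hg hh
  unfold pullback
  rw [hc]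
  rfl

/-- The group `Diff_ω(M)` of diffeomorphisms which preserve `ω`. -/
def DiffVol (vol : DForm n M n) : Subgroup (DiffGroup n M) where
  carrier := {g | pullback (toMap g) vol = vol}
  mul_mem' := by
    intro a b ha hb
    simp only [Set.mem_ofPred_eq] at *
    rw [pullback_mul, ha, hb]
  one_mem' := pullback_one vol
  inv_mem' := by
    intro a ha
    simp only [Set.mem_ofPred_eq] at *
    conv_lhs => rw [← ha]
    rw [← pullback_mul, mul_inv_cancel, pullback_one]

/-- The group `Diff_{ω,0}(M)`, the identity component of `Diff_ω(M)`. -/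
def DiffVolZero (vol : DForm n M n) : Subgroup (DiffGroup n M) := identityComponent (DiffVol vol)

variable (n M) in
/-- The diffeomorphisms which fix the boundary pointwise. -/
def DiffFixBoundary : Subgroup (DiffGroup n M) :=
  fixingSubgroup (DiffGroup n M) ((𝓡∂ n).boundary M)

/-- The group `Diff_{ω,0}(M, ∂M)`, the identity component of the subgroup of `Diff_{ω,0}(M)` whose
elements fix the boundary pointwise. -/
def DiffVolRel (vol : DForm n M n) : Subgroup (DiffGroup n M) :=
  identityComponent (DiffVolZero vol ⊓ DiffFixBoundary n M)

end Diffeos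

/-! ### Cochains -/

section GroupCochains

variable {G : Type*} [Group G]

/-- The coboundary
`δ c (g_1, …, g_{k+1}) = c (g_2, …, g_{k+1}) + ∑_{i=1}^k (-1)^i c (g_1, …, g_i g_{i+1}, …, g_{k+1})
  + (-1)^{k+1} c (g_1, …, g_k)^{g_{k+1}}`,
where `act g v` is `v^g`. -/
def coboundary {V : Type*} [AddCommGroup V] (act : G → V → V) {k : ℕ}
    (c : (Fin k → G) → V) : (Fin (k + 1) → G) → V := fun g =>
  c (fun i => g i.succ)
    + ∑ i : Fin k, (-1 : ℤ) ^ ((i : ℕ) + 1) • c (Fin.contractNth i.castSucc (· * ·) g)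
    + (-1 : ℤ) ^ (k + 1) • act (g (Fin.last k)) (c (fun i => g i.castSucc))

variable (G) in
/-- The coboundary on real cochains `G^k → ℝ`, i.e. on functions on the `k`-simplices of `BG^δ`. -/
def realCoboundary (k : ℕ) : ((Fin k → G) → ℝ) →ₗ[ℝ] ((Fin (k + 1) → G) → ℝ) where
  toFun := coboundary (fun _ r => r)
  map_add' := fun a b => by
    funext g
    simp only [coboundary, Pi.add_apply, smul_add, Finset.sum_add_distrib]
    abel
  map_smul' := fun r a => by
    funext g
    simp only [coboundary, Pi.smul_apply, RingHom.id_apply, smul_eq_mul, mul_add, Finset.mul_sum,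
      mul_smul_comm]

variable (G) in
/-- The differential of the complex of real cochains, on sequences `b = (b_k)_k`. -/
def realD (b : (k : ℕ) → (Fin k → G) → ℝ) : (k : ℕ) → (Fin k → G) → ℝ
  | 0 => 0
  | k + 1 => realCoboundary G k (b k)

variable (G) in
/-- Real cocycles. -/
abbrev realCocycles (k : ℕ) : Submodule ℝ ((Fin k → G) → ℝ) := LinearMap.ker (realCoboundary G k)

variable (G) in
/-- Real coboundaries. -/
def realCoboundaries : (k : ℕ) → Submodule ℝ ((Fin k → G) → ℝ)
  | 0 => ⊥
  | k + 1 => LinearMap.range (realCoboundary G k)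

variable (G) in
/-- `H^k(BG^δ; ℝ)`, as the cohomology of the complex of real cochains of `G`. -/
abbrev realCohomology (k : ℕ) : Type _ :=
  realCocycles G k ⧸ (realCoboundaries G k).submoduleOf (realCocycles G k)

/-- The cohomology class of a cocycle. -/
def cohomologyClass {k : ℕ} (z : realCocycles G k) : realCohomology G k :=
  Submodule.Quotient.mk z

end GroupCochains

section DoubleComplex

variable {n : ℕ} [NeZero n] {M : Type*} [TopologicalSpace M] [ChartedSpace (EuclideanHalfSpace n) M]

/-- Families `(c_{k,l})` of maps `c_{k,l} : G^k → {l-forms on M}`: elements of the total complex of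
the double complex of cochains of `G` with values in forms on `M`. A homogeneous element
of degree `m` has `c_{k,l} = 0` unless `k + l = m`. -/
abbrev FormCochains (G : Subgroup (DiffGroup n M)) : Type _ :=
  (k l : ℕ) → (Fin k → G) → DForm n M l

variable {G : Subgroup (DiffGroup n M)}

/-- The horizontal differential `δ`, with `α^g = g^* α`. -/
def deltaForm {k l : ℕ} (c : (Fin k → G) → DForm n M l) : (Fin (k + 1) → G) → DForm n M l :=
  coboundary (fun (g : G) α => pullback (toMap (g : DiffGroup n M)) α) c

/-- The vertical differential `d''`, which is `(-1)^k` times the exterior derivative. -/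
def dSecond {k l : ℕ} (c : (Fin k → G) → DForm n M l) : (Fin k → G) → DForm n M (l + 1) :=
  fun g => (-1 : ℤ) ^ k • dForm (c g)

/-- The total differential `d = δ + d''`. -/
def totalD (c : FormCochains G) : FormCochains G
  | 0, 0 => 0
  | k + 1, 0 => deltaForm (c k 0)
  | 0, l + 1 => dSecond (c 0 l)
  | k + 1, l + 1 => deltaForm (c k (l + 1)) + dSecond (c (k + 1) l)

variable (G) in
/-- The element `ω^{(n)}` of bidegree `(0, n)` which corresponds to the `n`-form `ω`. -/
def omegaCochain (vol : DForm n M n) : FormCochains G := fun k l _ =>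
  if h : k = 0 ∧ l = n then fun x => castDegree h.2.symm (vol x) else 0

/-- The wedge product on the total complex, which in bidegrees `(p, q)`, `(r, s)` is
`(α ∧ β)(g_1, …, g_{p+r}) = α(g_1, …, g_p)^{g_{p+1} ⋯ g_{p+r}} ∧ β(g_{p+1}, …, g_{p+r})`. -/
def cup (a b : FormCochains G) : FormCochains G := fun k l g x =>
  ∑ p : Fin (k + 1), ∑ q : Fin (l + 1),
    let g₁ : Fin (p : ℕ) → G := fun j => g ⟨j, by omega⟩
    let g₂ : Fin (k - p) → G := fun j => g ⟨p + j, by omega⟩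
    wedge (show (q : ℕ) + (l - q) = l by omega)
      (pullback (toMap ((List.ofFn g₂).prod : G).1) (a p q g₁) x)
      (b (k - p) (l - q) g₂ x)

/-- The choices `φ = φ^{(0)} + ⋯ + φ^{(n-1)}` in the definition of `c(M)`, where `φ^{(l)}` is
`φ (n-1-l) l`: elements of degree `n - 1` of the total complex with `dφ = ω^{(n)}`, such that for
every `l ≤ n - 2` the component `φ^{(l)}` has values in `Ω^l(M, ∂M)`. -/
structure IsPrimitive (vol : DForm n M n) (φ : FormCochains (DiffVolRel vol)) : Prop where
  smooth : ∀ k l g, IsSmooth (φ k l g)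
  degree : ∀ k l, k + l ≠ n - 1 → φ k l = 0
  d_eq : totalD φ = omegaCochain (DiffVolRel vol) vol
  rel : ∀ k l, l < n - 1 → ∀ g, IsRelForm (φ k l g)

variable [T2Space M] [CompactSpace M] [IsManifold (𝓡∂ n) ∞ M]

/-- Integration along the fibre `M`, with `M` oriented by `ω`: the components of form degree `n`
are integrated over `M`. -/
def fibreIntegral (vol : DForm n M n) (c : FormCochains G) : (k : ℕ) → (Fin k → G) → ℝ :=
  fun k g => integral vol (c k n g)

/-- The cochain `∫_M φ^{(0)} ∧ ω^{(n)}` of degree `n - 1`, whose class is `c(M)`. -/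
def cCochain (vol : DForm n M n) (φ : FormCochains (DiffVolRel vol)) :
    (Fin (n - 1) → DiffVolRel vol) → ℝ :=
  fun g => integral vol (fun x => wedge (zero_add n) (φ (n - 1) 0 g x) (vol x))

end DoubleComplex

end VolumeDiff

end

/-!
Write `n = m + 2` with `m` odd. In bidegrees, `dφ = ω^{(n)}` says that `δφ^{(l + 1)} = ± dφ^{(l)}`
for `l ≤ m`, that `dφ^{(n-1)} = ω`, and that `δφ^{(0)} = 0`. The component of `φ ∧ φ` which is
integrated is the sum of the forms `φ^{(b)} ∧ φ^{(n-b)}` with `1 ≤ b ≤ n - 1`.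

Put `X_a = ∫_M φ^{(b)} ∧ dφ^{(a)}` with `a + b = n - 1`. Integration over `M` commutes with `δ`,
since the group preserves the volume form (`integral_pullback`, `coboundarySeq_integral`). So the
Leibniz rule for `δ` (`coboundarySeq_cupSeq`) expresses `δ ∫_M φ^{(b)} ∧ φ^{(n-b)}` by the
integrals of `dφ^{(b-1)} ∧ φ^{(n-b)}` and `φ^{(b)} ∧ dφ^{(n-b-1)}`. The second is `X_{n-b-1}`, and
by Stokes' theorem (`integral_dForm`) the first is `± X_{n-b}`. Because `n` is odd, the signs are
such that the result is `X_{n-b} - X_{n-b-1}` (`integral_coboundarySeq_cupSeq`). Hence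
`δ ∫_M φ ∧ φ` telescopes to `X_{n-1} - X_0`. Here `X_{n-1} = ∫_M φ^{(0)} ∧ ω`, and by Stokes'
theorem again `X_0 = -∫_M ω ∧ φ^{(0)}`, which is `-X_{n-1}` (`pairing_last`, `pairing_zero`). This
gives the factor `2`.

Stokes' theorem is needed for the forms `φ^{(b)} ∧ φ^{(a)}` with `a + b = n - 1`. If `a ≤ n - 2`,
the second factor vanishes on `∂M`; otherwise the first factor is the function `φ^{(0)}`, which is
zero at boundary points, and this is not affected by the action of the group, which fixes them
(`vanishesOnBoundary_cupSeq`). The theorem is deduced by a partition of unity from the case of the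
half-space (`integral_extDerivWithin_halfSpace`), which in turn is the divergence theorem on a
box.

In the computations with cochains, a cochain of `k` variables is regarded as a function of
infinite sequences in the group, which avoids casts between the types `Fin (p + r)`.
-/

namespace VolumeDiff

/-! ### Algebra of the wedge product -/

section WedgeAlgebra

open Equiv Finset

/-- An alternating sum over the permutations of `Fin (l + 1)`, sorted by the value at `0`. -/
theorem sum_perm_sign_succ {l : ℕ} {V : Type*} (T : (Fin (l + 1) → V) → ℝ) (v : Fin (l + 1) → V) :
    ∑ τ : Perm (Fin (l + 1)), (Perm.sign τ : ℤ) • T (v ∘ τ) =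
      ∑ i : Fin (l + 1), (-1 : ℤ) ^ (i : ℕ) •
        ∑ σ : Perm (Fin l), (Perm.sign σ : ℤ) •
          T (Fin.cons (v i) (fun k => v (i.succAbove (σ k)))) := by
  simp only [Finset.smul_sum, smul_smul]
  rw [← Fintype.sum_prod_type']
  symm
  let F : Fin (l + 1) × Perm (Fin l) → Perm (Fin (l + 1)) := fun p =>
    p.1.cycleRange.symm * Perm.decomposeFin.symm (0, p.2)
  have F0 : ∀ p, F p 0 = p.1 := fun p => by simp [F]
  have Fs : ∀ p k, F p (Fin.succ k) = p.1.succAbove (p.2 k) := fun p k => by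
    simp [F]
  have hF : Function.Bijective F := by
    rw [Fintype.bijective_iff_injective_and_card]
    constructor
    · rintro ⟨i, σ⟩ ⟨j, τ⟩ h
      have h0 : i = j := (F0 (i, σ)).symm.trans
        ((congrArg (fun e : Perm (Fin (l + 1)) => e 0) h).trans (F0 (j, τ)))
      subst h0
      refine Prod.ext rfl (Equiv.ext fun k => ?_)
      have := congrArg (fun e : Perm (Fin (l + 1)) => e k.succ) h
      simp only [Fs] at this
      exact Fin.succAbove_right_injective this
    · simp [Fintype.card_perm, Nat.factorial_succ]
  refine Fintype.sum_bijective F hF _ _ fun p => ?_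
  have hs : (Perm.sign (F p) : ℤ) = (-1) ^ (p.1 : ℕ) * Perm.sign p.2 := by
    simp [F, Perm.sign_mul, Perm.decomposeFin.symm_sign]
  rw [hs]
  congr 2
  funext k
  refine Fin.cases ?_ (fun k => ?_) k
  · simp [F0]
  · simp [Fs]

theorem sum_perm_sign_comp {l : ℕ} {V : Type*} (T : (Fin l → V) → ℝ) (v : Fin l → V)
    (c : Perm (Fin l)) :
    ∑ τ : Perm (Fin l), (Perm.sign τ : ℤ) • T (v ∘ τ) =
      (Perm.sign c : ℤ) • ∑ τ : Perm (Fin l), (Perm.sign τ : ℤ) • T (v ∘ τ ∘ c) := by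
  rw [Finset.smul_sum]
  refine (Fintype.sum_equiv (Equiv.mulRight c) _ _ fun τ => ?_).symm
  rw [smul_smul]
  congr 1
  simp [mul_comm]

/-- Moving the argument in position `M` to the front changes an alternating sum by `(-1)^M`. -/
theorem sum_perm_sign_comp_cycleRange {l : ℕ} {V : Type*} (T : (Fin (l + 1) → V) → ℝ)
    (v : Fin (l + 1) → V) (M : Fin (l + 1)) :
    ∑ τ : Perm (Fin (l + 1)), (Perm.sign τ : ℤ) • T (v ∘ τ ∘ M.cycleRange.symm) =
      (-1 : ℤ) ^ (M : ℕ) • ∑ τ : Perm (Fin (l + 1)), (Perm.sign τ : ℤ) • T (v ∘ τ) := by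
  rw [sum_perm_sign_comp T v M.cycleRange.symm, smul_smul]
  simp [← mul_pow]

variable {V : Type*} [AddCommGroup V] [Module ℝ V] [TopologicalSpace V]

/-- The wedge product as a sum over permutations, without transport along `q + s = l`. -/
theorem wedge_apply {q s l : ℕ} (h : q + s = l) (α : V [⋀^Fin q]→L[ℝ] ℝ)
    (β : V [⋀^Fin s]→L[ℝ] ℝ) (v : Fin l → V) :
    wedge h α β v = (1 : ℝ) / (q.factorial * s.factorial) *
      ∑ σ : Perm (Fin l), (Perm.sign σ : ℤ) •
        (α (fun i => v (σ ⟨i, by omega⟩)) * β (fun i => v (σ ⟨q + i, by omega⟩))) := by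
  subst h
  simp only [wedge, castDegree, ContinuousAlternatingMap.smul_apply, smul_eq_mul,
    ContinuousMultilinearMap.alternatization_apply_apply, tensorForm_apply]
  rfl

theorem wedge_add_left {q s l : ℕ} (h : q + s = l) (α α' : V [⋀^Fin q]→L[ℝ] ℝ)
    (β : V [⋀^Fin s]→L[ℝ] ℝ) : wedge h (α + α') β = wedge h α β + wedge h α' β := by
  ext v
  simp only [wedge_apply, ContinuousAlternatingMap.add_apply, add_mul, smul_add,
    Finset.sum_add_distrib, mul_add]

theorem wedge_add_right {q s l : ℕ} (h : q + s = l) (α : V [⋀^Fin q]→L[ℝ] ℝ)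
    (β β' : V [⋀^Fin s]→L[ℝ] ℝ) : wedge h α (β + β') = wedge h α β + wedge h α β' := by
  ext v
  simp only [wedge_apply, ContinuousAlternatingMap.add_apply, mul_add, smul_add,
    Finset.sum_add_distrib]

theorem wedge_smul_left {q s l : ℕ} (h : q + s = l) (c : ℝ) (α : V [⋀^Fin q]→L[ℝ] ℝ)
    (β : V [⋀^Fin s]→L[ℝ] ℝ) : wedge h (c • α) β = c • wedge h α β := by
  ext v
  simp only [wedge_apply, ContinuousAlternatingMap.smul_apply, smul_eq_mul, Finset.mul_sum,
    mul_smul_comm, mul_assoc, mul_left_comm c]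

theorem wedge_smul_right {q s l : ℕ} (h : q + s = l) (c : ℝ) (α : V [⋀^Fin q]→L[ℝ] ℝ)
    (β : V [⋀^Fin s]→L[ℝ] ℝ) : wedge h α (c • β) = c • wedge h α β := by
  ext v
  simp only [wedge_apply, ContinuousAlternatingMap.smul_apply, smul_eq_mul, Finset.mul_sum,
    mul_smul_comm, mul_left_comm c]

theorem wedge_compContinuousLinearMap {W : Type*} [AddCommGroup W] [Module ℝ W]
    [TopologicalSpace W] {q s l : ℕ} (h : q + s = l) (α : V [⋀^Fin q]→L[ℝ] ℝ)
    (β : V [⋀^Fin s]→L[ℝ] ℝ) (f : W →L[ℝ] V) :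
    (wedge h α β).compContinuousLinearMap f =
      wedge h (α.compContinuousLinearMap f) (β.compContinuousLinearMap f) := by
  ext v
  simp only [wedge_apply, ContinuousAlternatingMap.compContinuousLinearMap_apply,
    Function.comp_def]

theorem sum_perm_sign_self {s : ℕ} (β : V [⋀^Fin s]→L[ℝ] ℝ) (v : Fin s → V) :
    ∑ σ : Perm (Fin s), (Perm.sign σ : ℤ) • β (fun i => v (σ i)) = s.factorial * β v := by
  have : ∀ σ : Perm (Fin s), (Perm.sign σ : ℤ) • β (fun i => v (σ i)) = β v := fun σ => by
    have h := β.toAlternatingMap.map_perm v σ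
    change β (v ∘ σ) = Perm.sign σ • β v at h
    change (Perm.sign σ : ℤ) • β (v ∘ σ) = _
    rw [h, Units.smul_def, smul_smul]
    simp
  simp [this, Fintype.card_perm]

theorem wedge_zero_left {s l : ℕ} (h : 0 + s = l) (f : V [⋀^Fin 0]→L[ℝ] ℝ)
    (β : V [⋀^Fin s]→L[ℝ] ℝ) :
    wedge h f β = f 0 • castDegree ((zero_add s).symm.trans h) β := by
  obtain rfl : s = l := by omega
  ext v
  have hf : ∀ w : Fin 0 → V, f w = f 0 := fun w => congrArg f (Subsingleton.elim _ _)
  rw [wedge_apply]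
  simp only [hf, zero_add, Fin.eta, ← mul_smul_comm]
  rw [← Finset.mul_sum, sum_perm_sign_self, ContinuousAlternatingMap.smul_apply, smul_eq_mul,
    castDegree]
  have := s.factorial_ne_zero
  simp
  field_simp

theorem wedge_zero_right {q l : ℕ} (h : q + 0 = l) (β : V [⋀^Fin q]→L[ℝ] ℝ)
    (f : V [⋀^Fin 0]→L[ℝ] ℝ) : wedge h β f = f 0 • castDegree h β := by
  obtain rfl : q = l := by omega
  ext v
  have hf : ∀ w : Fin 0 → V, f w = f 0 := fun w => congrArg f (Subsingleton.elim _ _)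
  rw [wedge_apply]
  simp only [hf, Fin.eta, ← smul_mul_assoc]
  rw [← Finset.sum_mul, sum_perm_sign_self, ContinuousAlternatingMap.smul_apply, smul_eq_mul,
    castDegree]
  have := q.factorial_ne_zero
  simp
  field_simp

end WedgeAlgebra

section WedgeNormed

open Equiv Finset

variable {E : Type*} [NormedAddCommGroup E] [NormedSpace ℝ E]

/-- The Leibniz rule on the level of derivatives, when only the first factor is differentiated. -/
theorem alternatizeUncurryFin_wedge_left {q s l : ℕ} (h : q + s = l) (h' : q + 1 + s = l + 1)
    (A : E →L[ℝ] E [⋀^Fin q]→L[ℝ] ℝ) (b : E [⋀^Fin s]→L[ℝ] ℝ)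
    (W : E →L[ℝ] E [⋀^Fin l]→L[ℝ] ℝ) (hW : ∀ v, W v = wedge h (A v) b) :
    ContinuousAlternatingMap.alternatizeUncurryFin W =
      wedge h' (ContinuousAlternatingMap.alternatizeUncurryFin A) b := by
  ext v
  -- Both sides are multiples of the alternatization of `A (v 0) (v 1, …) * b (…)`.
  let T : (Fin (l + 1) → E) → ℝ := fun w =>
    A (w 0) (fun i => w (Fin.succ ⟨i, by omega⟩)) * b (fun i => w (Fin.succ ⟨q + i, by omega⟩))
  have hL : ContinuousAlternatingMap.alternatizeUncurryFin W v =
      1 / (q.factorial * s.factorial) *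
        ∑ τ : Perm (Fin (l + 1)), (Perm.sign τ : ℤ) • T (v ∘ τ) := by
    rw [sum_perm_sign_succ, ContinuousAlternatingMap.alternatizeUncurryFin_apply, Finset.mul_sum]
    refine Finset.sum_congr rfl fun i _ => ?_
    rw [hW, wedge_apply, mul_smul_comm]
    rfl
  -- The summand in which the direction of differentiation is the `m`-th argument.
  have hm : ∀ m : Fin (q + 1), ∑ τ : Perm (Fin (l + 1)), (Perm.sign τ : ℤ) •
      ((-1 : ℤ) ^ (m : ℕ) • A (v (τ ⟨m, by omega⟩))
          (m.removeNth fun k => v (τ ⟨k, by omega⟩)) * b (fun i => v (τ ⟨q + 1 + i, by omega⟩))) =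
      ∑ τ : Perm (Fin (l + 1)), (Perm.sign τ : ℤ) • T (v ∘ τ) := by
    intro m
    let M : Fin (l + 1) := ⟨m, by omega⟩
    have hM := sum_perm_sign_comp_cycleRange T v M
    have h2 : ((-1 : ℤ) ^ (m : ℕ)) * (-1 : ℤ) ^ (m : ℕ) = 1 := by simp [← mul_pow]
    rw [show ∑ τ : Perm (Fin (l + 1)), (Perm.sign τ : ℤ) • T (v ∘ τ) =
      (-1 : ℤ) ^ (m : ℕ) • (-1 : ℤ) ^ (m : ℕ) •
        ∑ τ : Perm (Fin (l + 1)), (Perm.sign τ : ℤ) • T (v ∘ τ) by rw [smul_smul, h2, one_smul]]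
    change _ = (-1 : ℤ) ^ (m : ℕ) • ((-1 : ℤ) ^ (M : ℕ) • _)
    rw [← hM, Finset.smul_sum]
    refine Finset.sum_congr rfl fun τ _ => ?_
    rw [smul_comm, smul_mul_assoc]
    refine congrArg _ (congrArg _ ?_)
    have e1 : ∀ i : Fin q, M.succAbove ⟨i, by omega⟩ = ⟨m.succAbove i, by omega⟩ := fun i => by
      ext; simp only [Fin.succAbove, Fin.lt_def, M, Fin.val_castSucc]; split_ifs <;> simp
    have e2 : ∀ i : Fin s, M.succAbove ⟨q + i, by omega⟩ = ⟨q + 1 + i, by omega⟩ := fun i => by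
      ext; simp only [Fin.succAbove, Fin.lt_def, M, Fin.val_castSucc]; split_ifs <;> simp <;> omega
    simp only [T, Function.comp_apply, Fin.cycleRange_symm_zero, Fin.cycleRange_symm_succ, e1, e2]
    rfl
  have hR : wedge h' (ContinuousAlternatingMap.alternatizeUncurryFin A) b v =
      1 / ((q + 1).factorial * s.factorial) * ((q + 1 : ℕ) * ∑ τ : Perm (Fin (l + 1)),
        (Perm.sign τ : ℤ) • T (v ∘ τ)) := by
    rw [wedge_apply]
    simp only [ContinuousAlternatingMap.alternatizeUncurryFin_apply, Finset.sum_mul]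
    simp only [Finset.smul_sum]
    rw [Finset.sum_comm, Finset.sum_congr rfl fun m _ => hm m]
    simp
  rw [hL, hR]
  have := q.factorial_ne_zero
  have := s.factorial_ne_zero
  rw [Nat.factorial_succ]
  push_cast
  field_simp

/-- The Leibniz rule on the level of derivatives, when only the second factor is differentiated:
moving the direction of differentiation past the first factor gives the sign. -/
theorem alternatizeUncurryFin_wedge_right {q s l : ℕ} (h : q + s = l) (h' : q + (s + 1) = l + 1)
    (a : E [⋀^Fin q]→L[ℝ] ℝ) (B : E →L[ℝ] E [⋀^Fin s]→L[ℝ] ℝ)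
    (W : E →L[ℝ] E [⋀^Fin l]→L[ℝ] ℝ) (hW : ∀ v, W v = wedge h a (B v)) :
    ContinuousAlternatingMap.alternatizeUncurryFin W =
      (-1 : ℤ) ^ q • wedge h' a (ContinuousAlternatingMap.alternatizeUncurryFin B) := by
  ext v
  let T : (Fin (l + 1) → E) → ℝ := fun w =>
    a (fun i => w (Fin.succ ⟨i, by omega⟩)) * B (w 0) (fun i => w (Fin.succ ⟨q + i, by omega⟩))
  have hL : ContinuousAlternatingMap.alternatizeUncurryFin W v =
      1 / (q.factorial * s.factorial) *
        ∑ τ : Perm (Fin (l + 1)), (Perm.sign τ : ℤ) • T (v ∘ τ) := by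
    rw [sum_perm_sign_succ, ContinuousAlternatingMap.alternatizeUncurryFin_apply, Finset.mul_sum]
    refine Finset.sum_congr rfl fun i _ => ?_
    rw [hW, wedge_apply, mul_smul_comm]
    rfl
  have hm : ∀ m : Fin (s + 1), ∑ τ : Perm (Fin (l + 1)), (Perm.sign τ : ℤ) •
      (a (fun i => v (τ ⟨i, by omega⟩)) * (-1 : ℤ) ^ (m : ℕ) • B (v (τ ⟨q + m, by omega⟩))
          (m.removeNth fun k => v (τ ⟨q + k, by omega⟩))) =
      (-1 : ℤ) ^ q • ∑ τ : Perm (Fin (l + 1)), (Perm.sign τ : ℤ) • T (v ∘ τ) := by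
    intro m
    let M : Fin (l + 1) := ⟨q + m, by omega⟩
    have hM := sum_perm_sign_comp_cycleRange T v M
    have h2 : ((-1 : ℤ) ^ (m : ℕ)) * (-1 : ℤ) ^ (q + m : ℕ) = (-1) ^ q := by
      rw [pow_add, mul_left_comm]; simp [← mul_pow]
    rw [← h2, mul_smul]
    change _ = (-1 : ℤ) ^ (m : ℕ) • ((-1 : ℤ) ^ (M : ℕ) • _)
    rw [← hM, Finset.smul_sum]
    refine Finset.sum_congr rfl fun τ _ => ?_
    rw [smul_comm, mul_smul_comm]
    refine congrArg _ (congrArg _ ?_)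
    have e1 : ∀ i : Fin q, M.succAbove ⟨i, by omega⟩ = ⟨i, by omega⟩ := fun i => by
      ext; simp only [Fin.succAbove, Fin.lt_def, M, Fin.val_castSucc]
      split_ifs <;> simp
      omega
    have e2 : ∀ i : Fin s, M.succAbove ⟨q + i, by omega⟩ = ⟨q + m.succAbove i, by omega⟩ :=
      fun i => by
        ext; simp only [Fin.succAbove, Fin.lt_def, M, Fin.val_castSucc]
        split_ifs <;> simp <;> omega
    simp only [T, Function.comp_apply, Fin.cycleRange_symm_zero, Fin.cycleRange_symm_succ, e1, e2]
    rfl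
  have hR : wedge h' a (ContinuousAlternatingMap.alternatizeUncurryFin B) v =
      1 / (q.factorial * (s + 1).factorial) * ((s + 1 : ℕ) * (-1 : ℤ) ^ q •
        ∑ τ : Perm (Fin (l + 1)), (Perm.sign τ : ℤ) • T (v ∘ τ)) := by
    rw [wedge_apply]
    refine congrArg _ ?_
    simp only [ContinuousAlternatingMap.alternatizeUncurryFin_apply, Finset.mul_sum]
    simp only [Finset.smul_sum (N := ℝ) (s := (Finset.univ : Finset (Fin (s + 1))))]
    rw [Finset.sum_comm, Finset.sum_congr rfl fun m _ => hm m]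
    simp
  have h2 : ((-1 : ℝ) ^ q) * (-1 : ℝ) ^ q = 1 := by simp [← mul_pow]
  rw [ContinuousAlternatingMap.smul_apply, hL, hR]
  have := q.factorial_ne_zero
  have := s.factorial_ne_zero
  rw [Nat.factorial_succ]
  simp only [zsmul_eq_mul]
  push_cast
  field_simp
  rw [pow_two, h2, mul_one]

end WedgeNormed

/-! ### The wedge product and the exterior derivative on a vector space -/

section WedgeCalculus

variable {E : Type*} [NormedAddCommGroup E] [NormedSpace ℝ E] [FiniteDimensional ℝ E]

instance finiteDimensional_continuousAlternatingMap (l : ℕ) :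
    FiniteDimensional ℝ (E [⋀^Fin l]→L[ℝ] ℝ) := by
  let f : (E [⋀^Fin l]→L[ℝ] ℝ) →ₗ[ℝ] MultilinearMap ℝ (fun _ : Fin l => E) ℝ :=
    { toFun := fun α => α.toMultilinearMap
      map_add' := fun _ _ => rfl
      map_smul' := fun _ _ => rfl }
  refine FiniteDimensional.of_injective f fun α β h => ?_
  ext v
  exact congrArg (fun m : MultilinearMap ℝ (fun _ : Fin l => E) ℝ => m v) h

/-- The wedge product of alternating forms on a finite-dimensional space, as a continuous bilinear
map. -/
noncomputable def wedgeL {q s l : ℕ} (h : q + s = l) :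
    (E [⋀^Fin q]→L[ℝ] ℝ) →L[ℝ] (E [⋀^Fin s]→L[ℝ] ℝ) →L[ℝ] (E [⋀^Fin l]→L[ℝ] ℝ) :=
  LinearMap.toContinuousLinearMap
    { toFun := fun α => LinearMap.toContinuousLinearMap
        { toFun := fun β => wedge h α β
          map_add' := wedge_add_right h α
          map_smul' := fun c => wedge_smul_right h c α }
      map_add' := fun α α' => by ext1 β; exact wedge_add_left h α α' β
      map_smul' := fun c α => by ext1 β; exact wedge_smul_left h c α β }

theorem wedgeL_apply {q s l : ℕ} (h : q + s = l) (α : E [⋀^Fin q]→L[ℝ] ℝ)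
    (β : E [⋀^Fin s]→L[ℝ] ℝ) : wedgeL h α β = wedge h α β := rfl

theorem contDiffOn_wedge {q s l : ℕ} (h : q + s = l) {r : WithTop ℕ∞} {S : Set E}
    {α : E → E [⋀^Fin q]→L[ℝ] ℝ} {β : E → E [⋀^Fin s]→L[ℝ] ℝ}
    (hα : ContDiffOn ℝ r α S) (hβ : ContDiffOn ℝ r β S) :
    ContDiffOn ℝ r (fun y => wedge h (α y) (β y)) S :=
  (((wedgeL h).contDiff.comp_contDiffOn hα).clm_apply hβ :)

/-- The graded Leibniz rule for the exterior derivative. -/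
theorem extDerivWithin_wedge {q s l : ℕ} (h : q + s = l) {S : Set E} {x : E}
    {α : E → E [⋀^Fin q]→L[ℝ] ℝ} {β : E → E [⋀^Fin s]→L[ℝ] ℝ}
    (hα : DifferentiableWithinAt ℝ α S x) (hβ : DifferentiableWithinAt ℝ β S x)
    (hS : UniqueDiffWithinAt ℝ S x) :
    extDerivWithin (fun y => wedge h (α y) (β y)) S x =
      wedge (by omega : q + 1 + s = l + 1) (extDerivWithin α S x) (β x) +
        (-1 : ℤ) ^ q • wedge (by omega : q + (s + 1) = l + 1) (α x) (extDerivWithin β S x) := by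
  have hd := (wedgeL (E := E) h).fderivWithin_of_bilinear hα hβ hS
  simp only [wedgeL_apply] at hd
  rw [extDerivWithin, hd, ContinuousAlternatingMap.alternatizeUncurryFin_add,
    alternatizeUncurryFin_wedge_right h (by omega) (α x) (fderivWithin ℝ β S x) _ fun v => rfl,
    alternatizeUncurryFin_wedge_left h (by omega) (fderivWithin ℝ α S x) (β x) _ fun v => rfl]
  exact add_comm _ _

theorem contDiffWithinAt_compContinuousLinearMap {X : Type*} [NormedAddCommGroup X]
    [NormedSpace ℝ X] {l : ℕ} {r : WithTop ℕ∞} {S : Set X} {x : X}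
    {α : X → E [⋀^Fin l]→L[ℝ] ℝ} {A : X → E →L[ℝ] E}
    (hα : ContDiffWithinAt ℝ r α S x) (hA : ContDiffWithinAt ℝ r A S x) :
    ContDiffWithinAt ℝ r (fun y => (α y).compContinuousLinearMap (A y)) S x := by
  have : FiniteDimensional ℝ (ContinuousMultilinearMap ℝ (fun _ : Fin l => E) ℝ) := by
    let f : ContinuousMultilinearMap ℝ (fun _ : Fin l => E) ℝ →ₗ[ℝ]
        MultilinearMap ℝ (fun _ : Fin l => E) ℝ :=
      { toFun := fun α => α.toMultilinearMap
        map_add' := fun _ _ => rfl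
        map_smul' := fun _ _ => rfl }
    exact FiniteDimensional.of_injective f ContinuousMultilinearMap.toMultilinearMap_injective
  let J : (E [⋀^Fin l]→L[ℝ] ℝ) →L[ℝ] ContinuousMultilinearMap ℝ (fun _ : Fin l => E) ℝ :=
    ContinuousAlternatingMap.toContinuousMultilinearMapCLM ℝ
  -- Smoothness can be tested on the underlying multilinear maps, which depend on `A` through
  -- a continuous multilinear map.
  have hJ : Function.Injective J := fun α β h =>
    ContinuousAlternatingMap.toContinuousMultilinearMap_injective h
  obtain ⟨K, hK⟩ := J.toLinearMap.exists_leftInverse_of_injective (LinearMap.ker_eq_bot.2 hJ)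
  have h1 := ContinuousMultilinearMap.analyticAt_uncurry_compContinuousLinearMap (𝕜 := ℝ)
    (q := ((fun _ : Fin l => A x), J (α x)))
  have h2 := (h1.contDiffAt (n := r)).comp_contDiffWithinAt x
    ((contDiffWithinAt_pi.2 fun _ => hA).prodMk (J.contDiff.comp_contDiffWithinAt hα))
  have h3 := (LinearMap.toContinuousLinearMap K).contDiff.comp_contDiffWithinAt h2
  refine h3.congr (fun y _ => ?_) ?_ <;>
  exact (LinearMap.congr_fun hK _).symm

end WedgeCalculus

/-! ### Coordinate expressions, pullback and exterior derivative on the manifold -/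

section Charts

variable {n : ℕ} [NeZero n] {M : Type*} [TopologicalSpace M]
  [ChartedSpace (EuclideanHalfSpace n) M] {l : ℕ}

/-- The value of a form at a point, as a form on the model vector space: the tangent spaces of `M`
are all copies of that space. -/
def formAt (α : DForm n M l) (p : M) : (Eucl n) [⋀^Fin l]→L[ℝ] ℝ := α p

/-- A map of `M` read in the preferred charts at two points. -/
noncomputable abbrev chartMap (f : M → M) (x₀ x₁ : M) : Eucl n → Eucl n :=
  extChartAt (𝓡∂ n) x₁ ∘ f ∘ (extChartAt (𝓡∂ n) x₀).symm

variable [IsManifold (𝓡∂ n) ∞ M]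

omit [IsManifold (𝓡∂ n) ∞ M] in
theorem target_mem_nhdsWithin {x₀ : M} {y : Eucl n} (hy : y ∈ (extChartAt (𝓡∂ n) x₀).target) :
    (extChartAt (𝓡∂ n) x₀).target ∈ 𝓝[Set.range (𝓡∂ n)] y :=
  extChartAt_target_mem_nhdsWithin_of_mem hy

theorem contMDiffWithinAt_symm {x₀ : M} {y : Eucl n} (hy : y ∈ (extChartAt (𝓡∂ n) x₀).target) :
    ContMDiffWithinAt 𝓘(ℝ, Eucl n) (𝓡∂ n) ∞ (extChartAt (𝓡∂ n) x₀).symm (Set.range (𝓡∂ n)) y :=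
  ((contMDiffOn_extChartAt_symm x₀) y hy).mono_of_mem_nhdsWithin (target_mem_nhdsWithin hy)

theorem contDiffWithinAt_chartMap {f : M → M} (hf : ContMDiff (𝓡∂ n) (𝓡∂ n) ∞ f) {x₀ x₁ : M}
    {y : Eucl n} (hy : y ∈ (extChartAt (𝓡∂ n) x₀).target)
    (hy1 : f ((extChartAt (𝓡∂ n) x₀).symm y) ∈ (extChartAt (𝓡∂ n) x₁).source) :
    ContDiffWithinAt ℝ ∞ (chartMap f x₀ x₁) (Set.range (𝓡∂ n)) y := by
  rw [← contMDiffWithinAt_iff_contDiffWithinAt]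
  have h1 : ContMDiffAt (𝓡∂ n) 𝓘(ℝ, Eucl n) ∞ (extChartAt (𝓡∂ n) x₁)
      (f ((extChartAt (𝓡∂ n) x₀).symm y)) :=
    contMDiffAt_extChartAt' (by simpa using hy1)
  exact h1.comp_contMDiffWithinAt y ((hf _).comp_contMDiffWithinAt y (contMDiffWithinAt_symm hy))

theorem eventually_mem_source {f : M → M} (hf : ContMDiff (𝓡∂ n) (𝓡∂ n) ∞ f) {x₀ x₁ : M}
    {y : Eucl n} (hy : y ∈ (extChartAt (𝓡∂ n) x₀).target)
    (hy1 : f ((extChartAt (𝓡∂ n) x₀).symm y) ∈ (extChartAt (𝓡∂ n) x₁).source) :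
    ∀ᶠ z in 𝓝[Set.range (𝓡∂ n)] y, z ∈ (extChartAt (𝓡∂ n) x₀).target ∧
      f ((extChartAt (𝓡∂ n) x₀).symm z) ∈ (extChartAt (𝓡∂ n) x₁).source := by
  have h2 := ((hf _).comp_contMDiffWithinAt y (contMDiffWithinAt_symm hy)).continuousWithinAt
  filter_upwards [target_mem_nhdsWithin hy,
    h2.preimage_mem_nhdsWithin ((isOpen_extChartAt_source x₁).mem_nhds hy1)] with z h1 h2
  exact ⟨h1, h2⟩

/-- The coordinate expression of a pullback is the pullback of the coordinate expression. -/
theorem chartRep_pullback {f : M → M} (hf : ContMDiff (𝓡∂ n) (𝓡∂ n) ∞ f) (α : DForm n M l)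
    {x₀ x₁ : M} {y : Eucl n} (hy : y ∈ (extChartAt (𝓡∂ n) x₀).target)
    (hy1 : f ((extChartAt (𝓡∂ n) x₀).symm y) ∈ (extChartAt (𝓡∂ n) x₁).source) :
    chartRep (pullback f α) x₀ y =
      (chartRep α x₁ (chartMap f x₀ x₁ y)).compContinuousLinearMap
        (fderivWithin ℝ (chartMap f x₀ x₁) (Set.range (𝓡∂ n)) y) := by
  have hyR : y ∈ Set.range (𝓡∂ n) := extChartAt_target_subset_range x₀ hy
  have hu : UniqueMDiffWithinAt 𝓘(ℝ, Eucl n) (Set.range (𝓡∂ n)) y := (𝓡∂ n).uniqueMDiffOn y hyR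
  have hψ := (contDiffWithinAt_chartMap hf hy hy1).differentiableWithinAt (by simp)
  have hψm : MDifferentiableWithinAt 𝓘(ℝ, Eucl n) 𝓘(ℝ, Eucl n) (chartMap f x₀ x₁)
    (Set.range (𝓡∂ n)) y := hψ.mdifferentiableWithinAt
  have ht : chartMap f x₀ x₁ y ∈ (extChartAt (𝓡∂ n) x₁).target :=
    (extChartAt (𝓡∂ n) x₁).map_source hy1
  have hs1 := (contMDiffWithinAt_symm ht).mdifferentiableWithinAt (by simp)
  have hs0 := (contMDiffWithinAt_symm hy).mdifferentiableWithinAt (by simp)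
  have hfm : MDifferentiableAt (𝓡∂ n) (𝓡∂ n) f ((extChartAt (𝓡∂ n) x₀).symm y) :=
    (hf _).mdifferentiableAt (by simp)
  have hev := eventually_mem_source hf hy hy1
  have hp : (extChartAt (𝓡∂ n) x₁).symm (chartMap f x₀ x₁ y) =
    f ((extChartAt (𝓡∂ n) x₀).symm y) := (extChartAt (𝓡∂ n) x₁).left_inv hy1
  have hcomp : (mfderivWithin 𝓘(ℝ, Eucl n) (𝓡∂ n) (extChartAt (𝓡∂ n) x₁).symm
        (Set.range (𝓡∂ n)) (chartMap f x₀ x₁ y) : Eucl n →L[ℝ] Eucl n).comp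
        (fderivWithin ℝ (chartMap f x₀ x₁) (Set.range (𝓡∂ n)) y) =
      (mfderiv (𝓡∂ n) (𝓡∂ n) f ((extChartAt (𝓡∂ n) x₀).symm y) : Eucl n →L[ℝ] Eucl n).comp
        (mfderivWithin 𝓘(ℝ, Eucl n) (𝓡∂ n) (extChartAt (𝓡∂ n) x₀).symm (Set.range (𝓡∂ n)) y) := by
    have e2 := mfderiv_comp_mfderivWithin (I := 𝓘(ℝ, Eucl n)) (I' := 𝓡∂ n) (I'' := 𝓡∂ n) y
      hfm hs0 hu
    have e1 : mfderivWithin 𝓘(ℝ, Eucl n) (𝓡∂ n) ((extChartAt (𝓡∂ n) x₁).symm ∘ chartMap f x₀ x₁)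
        (Set.range (𝓡∂ n)) y = _ :=
      mfderivWithin_comp y hs1 hψm (fun z _ => by simp [chartMap, extChartAt]) hu
    rw [mfderivWithin_eq_fderivWithin] at e1
    refine e1.symm.trans (Eq.trans ?_ e2)
    refine Filter.EventuallyEq.mfderivWithin_eq ?_ hp
    filter_upwards [hev] with z hz
    exact (extChartAt (𝓡∂ n) x₁).left_inv hz.2
  change (formAt α (f ((extChartAt (𝓡∂ n) x₀).symm y))).compContinuousLinearMap
    ((mfderiv (𝓡∂ n) (𝓡∂ n) f ((extChartAt (𝓡∂ n) x₀).symm y) : Eucl n →L[ℝ] Eucl n).comp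
      (mfderivWithin 𝓘(ℝ, Eucl n) (𝓡∂ n) (extChartAt (𝓡∂ n) x₀).symm (Set.range (𝓡∂ n)) y)) = _
  rw [← hcomp, ← hp]
  rfl

omit [IsManifold (𝓡∂ n) ∞ M] in
theorem pullback_id (α : DForm n M l) : pullback id α = α := by
  funext x
  unfold pullback
  rw [mfderiv_id]
  rfl

/-- A form is recovered from its coordinate expression in any chart. -/
theorem formAt_eq (α : DForm n M l) {x₀ x : M} (hx : x ∈ (extChartAt (𝓡∂ n) x₀).source) :
    formAt α x = (chartRep α x₀ (extChartAt (𝓡∂ n) x₀ x)).compContinuousLinearMap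
      (mfderiv (𝓡∂ n) 𝓘(ℝ, Eucl n) (extChartAt (𝓡∂ n) x₀) x : Eucl n →L[ℝ] Eucl n) := by
  have h := mfderivWithin_extChartAt_symm_comp_mfderiv_extChartAt' (I := 𝓡∂ n) hx
  have hp : (extChartAt (𝓡∂ n) x₀).symm (extChartAt (𝓡∂ n) x₀ x) = x :=
    (extChartAt (𝓡∂ n) x₀).left_inv hx
  change _ = (formAt α ((extChartAt (𝓡∂ n) x₀).symm
    (extChartAt (𝓡∂ n) x₀ x))).compContinuousLinearMap
      ((mfderivWithin 𝓘(ℝ, Eucl n) (𝓡∂ n) (extChartAt (𝓡∂ n) x₀).symm (Set.range (𝓡∂ n))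
        (extChartAt (𝓡∂ n) x₀ x) : Eucl n →L[ℝ] Eucl n).comp
        (mfderiv (𝓡∂ n) 𝓘(ℝ, Eucl n) (extChartAt (𝓡∂ n) x₀) x : Eucl n →L[ℝ] Eucl n))
  have h' : (mfderivWithin 𝓘(ℝ, Eucl n) (𝓡∂ n) (extChartAt (𝓡∂ n) x₀).symm (Set.range (𝓡∂ n))
        (extChartAt (𝓡∂ n) x₀ x) : Eucl n →L[ℝ] Eucl n).comp
        (mfderiv (𝓡∂ n) 𝓘(ℝ, Eucl n) (extChartAt (𝓡∂ n) x₀) x : Eucl n →L[ℝ] Eucl n) =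
        ContinuousLinearMap.id ℝ (Eucl n) := h
  rw [h', hp]
  rfl

/-- Forms agree if at every point they have the same expression in the chart at that point. -/
theorem dForm_ext {α β : DForm n M l} (h : ∀ x : M, chartRep α x (extChartAt (𝓡∂ n) x x) =
    chartRep β x (extChartAt (𝓡∂ n) x x)) : α = β := by
  funext x
  have ha := formAt_eq α (mem_extChartAt_source (I := 𝓡∂ n) x)
  have hb := formAt_eq β (mem_extChartAt_source (I := 𝓡∂ n) x)
  rw [h x, ← hb] at ha
  exact ha

/-- The exterior derivative commutes with a change of charts, or more generally with a smooth map
read in charts. -/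
theorem extDerivWithin_chartMap {f : M → M} (hf : ContMDiff (𝓡∂ n) (𝓡∂ n) ∞ f) {x₀ x₁ : M}
    {y : Eucl n} (hy : y ∈ (extChartAt (𝓡∂ n) x₀).target)
    (hy1 : f ((extChartAt (𝓡∂ n) x₀).symm y) ∈ (extChartAt (𝓡∂ n) x₁).source)
    {α : DForm n M l} (hα : IsSmooth α) :
    extDerivWithin (chartRep (pullback f α) x₀) (Set.range (𝓡∂ n)) y =
      (extDerivWithin (chartRep α x₁) (Set.range (𝓡∂ n))
        (chartMap f x₀ x₁ y)).compContinuousLinearMap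
        (fderivWithin ℝ (chartMap f x₀ x₁) (Set.range (𝓡∂ n)) y) := by
  have hyR : y ∈ Set.range (𝓡∂ n) := extChartAt_target_subset_range x₀ hy
  have ht : chartMap f x₀ x₁ y ∈ (extChartAt (𝓡∂ n) x₁).target :=
    (extChartAt (𝓡∂ n) x₁).map_source hy1
  have hd : DifferentiableWithinAt ℝ (chartRep α x₁) (Set.range (𝓡∂ n)) (chartMap f x₀ x₁ y) :=
    ((hα x₁).differentiableOn (by simp) _ ht).mono_of_mem_nhdsWithin (target_mem_nhdsWithin ht)
  rw [← extDerivWithin_pullback hd (contDiffWithinAt_chartMap hf hy hy1)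
    (by simpa using ENat.LEInfty.out)
    (𝓡∂ n).uniqueDiffOn ((𝓡∂ n).range_subset_closure_interior hyR) hyR
    (fun z _ => by simp [chartMap, extChartAt])]
  refine Filter.EventuallyEq.extDerivWithin_eq_of_mem ?_ hyR
  filter_upwards [eventually_mem_source hf hy hy1] with z hz
  exact chartRep_pullback hf α hz.1 hz.2

/-- The coordinate expression of `dα` is the exterior derivative of the coordinate expression. -/
theorem chartRep_dForm {α : DForm n M l} (hα : IsSmooth α) {x₀ : M} {y : Eucl n}
    (hy : y ∈ (extChartAt (𝓡∂ n) x₀).target) :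
    chartRep (dForm α) x₀ y = extDerivWithin (chartRep α x₀) (Set.range (𝓡∂ n)) y := by
  have hyR : y ∈ Set.range (𝓡∂ n) := extChartAt_target_subset_range x₀ hy
  have hu : UniqueMDiffWithinAt 𝓘(ℝ, Eucl n) (Set.range (𝓡∂ n)) y := (𝓡∂ n).uniqueMDiffOn y hyR
  set x := (extChartAt (𝓡∂ n) x₀).symm y with hx
  have hxs : x ∈ (extChartAt (𝓡∂ n) x).source := mem_extChartAt_source x
  have h1 := extDerivWithin_chartMap (f := id) contMDiff_id hy hxs hα
  rw [pullback_id] at h1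
  rw [h1]
  have hs0 := (contMDiffWithinAt_symm hy).mdifferentiableWithinAt (by simp)
  have hm : MDifferentiableAt (𝓡∂ n) 𝓘(ℝ, Eucl n) (extChartAt (𝓡∂ n) x)
      ((extChartAt (𝓡∂ n) x₀).symm y) := mdifferentiableAt_extChartAt (mem_chart_source _ x)
  have e2 := mfderiv_comp_mfderivWithin (I := 𝓘(ℝ, Eucl n)) (I' := 𝓡∂ n)
    (I'' := 𝓘(ℝ, Eucl n)) y hm hs0 hu
  rw [mfderivWithin_eq_fderivWithin] at e2
  have e3 : fderivWithin ℝ (chartMap id x₀ x) (Set.range (𝓡∂ n)) y = _ := e2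
  rw [e3]
  rfl

theorem isSmooth_dForm {α : DForm n M l} (hα : IsSmooth α) : IsSmooth (dForm α) := by
  intro x₀ y hy
  have hyR : y ∈ Set.range (𝓡∂ n) := extChartAt_target_subset_range x₀ hy
  have h1 : ContDiffWithinAt ℝ ∞ (chartRep α x₀) (Set.range (𝓡∂ n)) y :=
    (hα x₀ y hy).mono_of_mem_nhdsWithin (target_mem_nhdsWithin hy)
  have h2 : ContDiffWithinAt ℝ ∞ (extDerivWithin (chartRep α x₀) (Set.range (𝓡∂ n)))
      (Set.range (𝓡∂ n)) y :=
    (ContinuousAlternatingMap.alternatizeUncurryFinCLM ℝ (Eucl n) ℝ).contDiff.comp_contDiffWithinAt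
      (h1.fderivWithin_right (𝓡∂ n).uniqueDiffOn (by simp) hyR)
  exact (h2.mono (extChartAt_target_subset_range x₀)).congr (fun z hz => chartRep_dForm hα hz)
    (chartRep_dForm hα hy)

theorem isSmooth_pullback {f : M → M} (hf : ContMDiff (𝓡∂ n) (𝓡∂ n) ∞ f) {α : DForm n M l}
    (hα : IsSmooth α) : IsSmooth (pullback f α) := by
  intro x₀ y hy
  have hyR : y ∈ Set.range (𝓡∂ n) := extChartAt_target_subset_range x₀ hy
  have hy1 := mem_extChartAt_source (I := 𝓡∂ n) (f ((extChartAt (𝓡∂ n) x₀).symm y))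
  have ht := (extChartAt (𝓡∂ n) (f ((extChartAt (𝓡∂ n) x₀).symm y))).map_source hy1
  have hψ := contDiffWithinAt_chartMap hf hy hy1
  have h1 : ContDiffWithinAt ℝ ∞ (chartRep α (f ((extChartAt (𝓡∂ n) x₀).symm y)))
      (Set.range (𝓡∂ n)) (chartMap f x₀ (f ((extChartAt (𝓡∂ n) x₀).symm y)) y) :=
    (hα _ _ ht).mono_of_mem_nhdsWithin (target_mem_nhdsWithin ht)
  have h2 := h1.comp y hψ (fun z _ => by simp [chartMap, extChartAt])
  have h3 := contDiffWithinAt_compContinuousLinearMap h2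
    (hψ.fderivWithin_right (m := ∞) (𝓡∂ n).uniqueDiffOn (by simp) hyR)
  refine (ContDiffWithinAt.congr_of_eventuallyEq_of_mem h3 ?_ hyR).mono
    (extChartAt_target_subset_range x₀)
  filter_upwards [eventually_mem_source hf hy hy1] with z hz
  exact chartRep_pullback hf α hz.1 hz.2

theorem dForm_pullback {f : M → M} (hf : ContMDiff (𝓡∂ n) (𝓡∂ n) ∞ f) {α : DForm n M l}
    (hα : IsSmooth α) : dForm (pullback f α) = pullback f (dForm α) := by
  refine dForm_ext fun x => ?_
  have hy := mem_extChartAt_target (I := 𝓡∂ n) x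
  have hy1 := mem_extChartAt_source (I := 𝓡∂ n)
    (f ((extChartAt (𝓡∂ n) x).symm (extChartAt (𝓡∂ n) x x)))
  rw [chartRep_dForm (isSmooth_pullback hf hα) hy, chartRep_pullback hf _ hy hy1,
    extDerivWithin_chartMap hf hy hy1 hα]
  exact congrArg (fun a => ContinuousAlternatingMap.compContinuousLinearMap a _)
    (chartRep_dForm hα ((extChartAt (𝓡∂ n) _).map_source hy1)).symm

/-- The pointwise wedge product of two forms on `M`. -/
noncomputable def wedgeForm {q s l : ℕ} (h : q + s = l) (α : DForm n M q) (β : DForm n M s) :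
    DForm n M l := fun x => wedge h (α x) (β x)

omit [IsManifold (𝓡∂ n) ∞ M] in
theorem chartRep_wedgeForm {q s l : ℕ} (h : q + s = l) (α : DForm n M q) (β : DForm n M s)
    (x₀ : M) (y : Eucl n) :
    chartRep (wedgeForm h α β) x₀ y = wedge h (chartRep α x₀ y) (chartRep β x₀ y) :=
  wedge_compContinuousLinearMap h _ _ _

omit [IsManifold (𝓡∂ n) ∞ M] in
theorem pullback_wedgeForm {q s l : ℕ} (h : q + s = l) (f : M → M) (α : DForm n M q)
    (β : DForm n M s) :
    pullback f (wedgeForm h α β) = wedgeForm h (pullback f α) (pullback f β) := by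
  funext x
  exact wedge_compContinuousLinearMap h _ _ _

omit [IsManifold (𝓡∂ n) ∞ M] in
theorem isSmooth_wedgeForm {q s l : ℕ} (h : q + s = l) {α : DForm n M q} {β : DForm n M s}
    (hα : IsSmooth α) (hβ : IsSmooth β) : IsSmooth (wedgeForm h α β) := fun x₀ =>
  (contDiffOn_wedge h (hα x₀) (hβ x₀)).congr fun y _ => chartRep_wedgeForm h α β x₀ y

theorem dForm_wedgeForm {q s l : ℕ} (h : q + s = l) {α : DForm n M q} {β : DForm n M s}
    (hα : IsSmooth α) (hβ : IsSmooth β) :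
    dForm (wedgeForm h α β) = wedgeForm (by omega) (dForm α) β +
      (-1 : ℤ) ^ q • wedgeForm (by omega) α (dForm β) := by
  refine dForm_ext fun x => ?_
  have hy := mem_extChartAt_target (I := 𝓡∂ n) x
  have hd : ∀ {k : ℕ} {γ : DForm n M k}, IsSmooth γ → DifferentiableWithinAt ℝ (chartRep γ x)
      (Set.range (𝓡∂ n)) (extChartAt (𝓡∂ n) x x) := fun hγ =>
    ((hγ x).differentiableOn (by simp) _ hy).mono_of_mem_nhdsWithin (target_mem_nhdsWithin hy)
  rw [chartRep_dForm (isSmooth_wedgeForm h hα hβ) hy]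
  have e := extDerivWithin_wedge h (hd hα) (hd hβ)
    ((𝓡∂ n).uniqueDiffOn _ (extChartAt_target_subset_range x hy))
  have e0 : (fun y => wedge h (chartRep α x y) (chartRep β x y)) = chartRep (wedgeForm h α β) x :=
    funext fun y => (chartRep_wedgeForm h α β x y).symm
  rw [e0, ← chartRep_dForm hα hy, ← chartRep_dForm hβ hy, ← chartRep_wedgeForm,
    ← chartRep_wedgeForm] at e
  rw [e]
  ext v
  rfl

omit [IsManifold (𝓡∂ n) ∞ M] in
theorem vanishesOnBoundary_wedgeForm_right {q s l : ℕ} (h : q + s = l) (α : DForm n M q)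
    {β : DForm n M s} (hβ : VanishesOnBoundary β) : VanishesOnBoundary (wedgeForm h α β) := by
  intro x hx v hv
  rw [wedgeForm, wedge_apply]
  simp only [hβ x hx _ fun i => hv _, mul_zero, smul_zero, Finset.sum_const_zero]

end Charts

/-! ### Forms of top degree and the integral -/

section TopForms

variable {n : ℕ}

/-- The value of a top degree form on the standard basis. -/
noncomputable def topCoeff (α : (Eucl n) [⋀^Fin n]→L[ℝ] ℝ) : ℝ :=
  α fun j => EuclideanSpace.single j (1 : ℝ)

theorem topForm_apply (α : (Eucl n) [⋀^Fin n]→L[ℝ] ℝ) (v : Fin n → Eucl n) :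
    α v = topCoeff α * (EuclideanSpace.basisFun (Fin n) ℝ).toBasis.det v := by
  have h := α.toAlternatingMap.eq_smul_basis_det (EuclideanSpace.basisFun (Fin n) ℝ).toBasis
  have h2 := congrArg (fun a : AlternatingMap ℝ (Eucl n) ℝ (Fin n) => a v) h
  have hb : (fun j => EuclideanSpace.single j (1 : ℝ)) =
      ⇑(EuclideanSpace.basisFun (Fin n) ℝ).toBasis := by ext; simp
  rw [topCoeff, hb]
  exact h2

theorem topForm_ext {α β : (Eucl n) [⋀^Fin n]→L[ℝ] ℝ} (h : topCoeff α = topCoeff β) : α = β := by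
  ext v
  rw [topForm_apply, h, ← topForm_apply]

theorem topCoeff_comp (α : (Eucl n) [⋀^Fin n]→L[ℝ] ℝ) (A : Eucl n →L[ℝ] Eucl n) :
    topCoeff (α.compContinuousLinearMap A) = A.det * topCoeff α := by
  have hb : (fun j => EuclideanSpace.single j (1 : ℝ)) =
      ⇑(EuclideanSpace.basisFun (Fin n) ℝ).toBasis := by ext; simp
  have h := Module.Basis.det_comp (EuclideanSpace.basisFun (Fin n) ℝ).toBasis
    (A : Eucl n →ₗ[ℝ] Eucl n) (fun j => EuclideanSpace.single j (1 : ℝ))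
  rw [hb, Module.Basis.det_self, mul_one, ← hb] at h
  rw [topCoeff, ContinuousAlternatingMap.compContinuousLinearMap_apply, topForm_apply, mul_comm]
  exact congrArg (· * topCoeff α) h

end TopForms

section Integral

open MeasureTheory Set

variable {n : ℕ} [NeZero n] {M : Type*} [TopologicalSpace M]
  [ChartedSpace (EuclideanHalfSpace n) M]

theorem coeff_eq_topCoeff (α : DForm n M n) (x₀ : M) (y : Eucl n) :
    coeff α x₀ y = topCoeff (chartRep α x₀ y) := rfl

theorem sign_mul_self_eq_abs (c : ℝ) : Real.sign c * c = |c| := by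
  rcases lt_trichotomy c 0 with h | h | h
  · rw [Real.sign_of_neg h, abs_of_neg h]; ring
  · simp [h]
  · rw [Real.sign_of_pos h, abs_of_pos h]; ring

theorem measurableSet_extChartAt_target (x₀ : M) :
    MeasurableSet (extChartAt (𝓡∂ n) x₀).target := by
  rw [extChartAt_target]
  refine (((chartAt (EuclideanHalfSpace n) x₀).open_target.preimage
    (𝓡∂ n).continuous_symm).measurableSet).inter (𝓡∂ n).isClosed_range.measurableSet

/-- The integral of the density `|vol|` times a function in the chart at `i`. -/
noncomputable def chartIntegral (vol : DForm n M n) (i : M) (F : M → ℝ) : ℝ :=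
  ∫ y in (extChartAt (𝓡∂ n) i).target, |coeff vol i y| * F ((extChartAt (𝓡∂ n) i).symm y)

/-- The function `F` with `α = F • vol`, for a volume form `vol`. -/
noncomputable def ratio (vol α : DForm n M n) (x : M) : ℝ :=
  topCoeff (formAt α x) / topCoeff (formAt vol x)

variable {vol : DForm n M n}

theorem topCoeff_ne_zero (hvol : IsVolumeForm vol) (x : M) : topCoeff (formAt vol x) ≠ 0 := by
  intro h
  refine hvol.2 x (topForm_ext (α := formAt vol x) (β := 0) (h.trans ?_))
  rfl

theorem formAt_eq_ratio (hvol : IsVolumeForm vol) (α : DForm n M n) (x : M) :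
    formAt α x = ratio vol α x • formAt vol x := by
  refine topForm_ext ?_
  change _ = ratio vol α x * topCoeff (formAt vol x)
  rw [ratio, div_mul_cancel₀ _ (topCoeff_ne_zero hvol x)]

theorem ratio_eq_of_eq (hvol : IsVolumeForm vol) {α : DForm n M n} {x : M} {c : ℝ}
    (h : formAt α x = c • formAt vol x) : ratio vol α x = c := by
  rw [ratio, h]
  change c * topCoeff (formAt vol x) / topCoeff (formAt vol x) = c
  rw [mul_div_cancel_right₀ _ (topCoeff_ne_zero hvol x)]

theorem coeff_eq_ratio (hvol : IsVolumeForm vol) (α : DForm n M n) (i : M) (y : Eucl n) :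
    coeff α i y = ratio vol α ((extChartAt (𝓡∂ n) i).symm y) * coeff vol i y := by
  have h := formAt_eq_ratio hvol α ((extChartAt (𝓡∂ n) i).symm y)
  change (formAt α ((extChartAt (𝓡∂ n) i).symm y)) _ = _
  rw [h]
  rfl

theorem continuousOn_coeff {α : DForm n M n} (hα : IsSmooth α) (i : M) :
    ContinuousOn (coeff α i) (extChartAt (𝓡∂ n) i).target := by
  have h := (hα i).continuousOn
  have h2 : Continuous fun a : (Eucl n) [⋀^Fin n]→L[ℝ] ℝ => topCoeff a :=
    (ContinuousAlternatingMap.apply ℝ (Eucl n) ℝ _).continuous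
  exact h2.comp_continuousOn h

variable [IsManifold (𝓡∂ n) ∞ M]

theorem coeff_ne_zero (hvol : IsVolumeForm vol) {i : M} {y : Eucl n}
    (hy : y ∈ (extChartAt (𝓡∂ n) i).target) : coeff vol i y ≠ 0 := by
  intro h
  have hx := (extChartAt (𝓡∂ n) i).map_target hy
  have h1 := formAt_eq vol hx
  rw [(extChartAt (𝓡∂ n) i).right_inv hy] at h1
  have h0 : chartRep vol i y = 0 := topForm_ext (h.trans rfl)
  rw [h0] at h1
  exact hvol.2 _ h1

theorem continuous_ratio (hvol : IsVolumeForm vol) {α : DForm n M n} (hα : IsSmooth α) :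
    Continuous (ratio vol α) := by
  rw [continuous_iff_continuousAt]
  intro x
  have hx := mem_extChartAt_source (I := 𝓡∂ n) x
  have h1 : ContinuousOn (fun z => coeff α x (extChartAt (𝓡∂ n) x z) /
      coeff vol x (extChartAt (𝓡∂ n) x z)) (extChartAt (𝓡∂ n) x).source := by
    refine ContinuousOn.div ?_ ?_ fun z hz =>
      coeff_ne_zero hvol ((extChartAt (𝓡∂ n) x).map_source hz)
    · exact (continuousOn_coeff hα x).comp (continuousOn_extChartAt x)
        (extChartAt (𝓡∂ n) x).mapsTo
    · exact (continuousOn_coeff hvol.1 x).comp (continuousOn_extChartAt x)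
        (extChartAt (𝓡∂ n) x).mapsTo
  refine (h1.continuousAt (extChartAt_source_mem_nhds x)).congr ?_
  filter_upwards [extChartAt_source_mem_nhds (I := 𝓡∂ n) x] with z hz
  rw [coeff_eq_ratio hvol α, (extChartAt (𝓡∂ n) x).left_inv hz,
    mul_div_cancel_right₀ _ (coeff_ne_zero hvol ((extChartAt (𝓡∂ n) x).map_source hz))]

/-- Change of variables for a diffeomorphism which preserves the volume form. -/
theorem chartIntegral_comp (g : DiffGroup n M) (hg : pullback (toMap g) vol = vol) (i j : M)
    (H : M → ℝ) (hH : ∀ x, H (toMap g x) ≠ 0 →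
      x ∈ (extChartAt (𝓡∂ n) i).source ∧ toMap g x ∈ (extChartAt (𝓡∂ n) j).source) :
    chartIntegral vol i (fun x => H (toMap g x)) = chartIntegral vol j H := by
  set φ := extChartAt (𝓡∂ n) i with hφ
  set ψ := chartMap (n := n) (toMap g) i j with hψ
  let A : Set (Eucl n) := {y | y ∈ φ.target ∧ toMap g (φ.symm y) ∈ (extChartAt (𝓡∂ n) j).source}
  have hgsm : ContMDiff (𝓡∂ n) (𝓡∂ n) ∞ (toMap g) := g.2.1
  have hinj : Function.Injective (toMap g) := (g : Equiv.Perm M).injective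
  have hAR : A ⊆ range (𝓡∂ n) := fun y hy => extChartAt_target_subset_range i hy.1
  have hAm : MeasurableSet A := by
    have h1 : ContinuousOn (fun y => toMap g (φ.symm y)) φ.target :=
      hgsm.continuous.comp_continuousOn (continuousOn_extChartAt_symm i)
    obtain ⟨u, hu, hu2⟩ := continuousOn_iff'.1 h1 _ (isOpen_extChartAt_source (I := 𝓡∂ n) j)
    have : A = u ∩ φ.target := by
      rw [← hu2]; ext y; simp only [A, mem_ofPred_eq, mem_inter_iff, mem_preimage]; tauto
    rw [this]
    exact hu.measurableSet.inter (measurableSet_extChartAt_target i)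
  have hder : ∀ y ∈ A, HasFDerivWithinAt ψ (fderivWithin ℝ ψ (range (𝓡∂ n)) y) A y := fun y hy =>
    ((contDiffWithinAt_chartMap hgsm hy.1 hy.2).differentiableWithinAt
      (by simp)).hasFDerivWithinAt.mono hAR
  have hsymm : ∀ y ∈ A, (extChartAt (𝓡∂ n) j).symm (ψ y) = toMap g (φ.symm y) := fun y hy =>
    (extChartAt (𝓡∂ n) j).left_inv hy.2
  have hψinj : InjOn ψ A := by
    intro y hy z hz h
    have h1 := congrArg (extChartAt (𝓡∂ n) j).symm h
    rw [hsymm y hy, hsymm z hz] at h1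
    exact φ.symm.injOn hy.1 hz.1 (hinj h1)
  have hψA : ψ '' A ⊆ (extChartAt (𝓡∂ n) j).target := by
    rintro _ ⟨y, hy, rfl⟩
    exact (extChartAt (𝓡∂ n) j).map_source hy.2
  have e1 : chartIntegral vol i (fun x => H (toMap g x)) =
      ∫ y in A, |coeff vol i y| * H (toMap g (φ.symm y)) := by
    refine setIntegral_eq_of_subset_of_forall_sdiff_eq_zero (measurableSet_extChartAt_target i)
      (fun y hy => hy.1) fun y hy => ?_
    by_contra hne
    exact hy.2 ⟨hy.1, (hH _ (right_ne_zero_of_mul hne)).2⟩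
  have e2 : chartIntegral vol j H =
      ∫ y in ψ '' A, |coeff vol j y| * H ((extChartAt (𝓡∂ n) j).symm y) := by
    refine setIntegral_eq_of_subset_of_forall_sdiff_eq_zero (measurableSet_extChartAt_target j)
      hψA fun z hz => ?_
    by_contra hne
    obtain ⟨x, hx⟩ := (g : Equiv.Perm M).surjective ((extChartAt (𝓡∂ n) j).symm z)
    change toMap g x = _ at hx
    have h2 := right_ne_zero_of_mul hne
    rw [← hx] at h2
    obtain ⟨h3, h4⟩ := hH x h2
    refine hz.2 ⟨φ x, ⟨φ.map_source h3, ?_⟩, ?_⟩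
    · rwa [φ.left_inv h3]
    · change extChartAt (𝓡∂ n) j (toMap g (φ.symm (φ x))) = z
      rw [φ.left_inv h3, hx, (extChartAt (𝓡∂ n) j).right_inv hz.1]
  rw [e1, e2, integral_image_eq_integral_abs_det_fderiv_smul volume hAm hder hψinj]
  refine setIntegral_congr_fun hAm fun y hy => ?_
  have hc := chartRep_pullback hgsm vol hy.1 hy.2
  rw [hg] at hc
  have hc2 : coeff vol i y = (fderivWithin ℝ ψ (range (𝓡∂ n)) y).det * coeff vol j (ψ y) := by
    rw [coeff_eq_topCoeff, hc, topCoeff_comp]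
    rfl
  simp only [hsymm y hy, hc2, abs_mul, smul_eq_mul, mul_assoc]

variable [T2Space M] [CompactSpace M]

omit [IsManifold (𝓡∂ n) ∞ M] [CompactSpace M] [T2Space M] in
theorem integrableOn_chartIntegral (hvol : IsSmooth vol) {i : M} {F : M → ℝ} (hF : Continuous F)
    {K : Set M} (hK : IsCompact K) (hKi : K ⊆ (chartAt (EuclideanHalfSpace n) i).source)
    (hFK : ∀ x, x ∉ K → F x = 0) :
    IntegrableOn (fun y => |coeff vol i y| * F ((extChartAt (𝓡∂ n) i).symm y))
      (extChartAt (𝓡∂ n) i).target := by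
  rw [← extChartAt_source (I := 𝓡∂ n)] at hKi
  have hsub : extChartAt (𝓡∂ n) i '' K ⊆ (extChartAt (𝓡∂ n) i).target :=
    image_subset_iff.2 fun x hx => (extChartAt (𝓡∂ n) i).map_source (hKi hx)
  have hc : IsCompact (extChartAt (𝓡∂ n) i '' K) :=
    hK.image_of_continuousOn ((continuousOn_extChartAt i).mono hKi)
  refine IntegrableOn.of_forall_sdiff_eq_zero (s := extChartAt (𝓡∂ n) i '' K) ?_
    (measurableSet_extChartAt_target i) fun y hy => ?_
  · refine ContinuousOn.integrableOn_compact hc ?_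
    refine ContinuousOn.mul ((continuousOn_coeff hvol i).mono hsub).abs ?_
    exact hF.comp_continuousOn ((continuousOn_extChartAt_symm i).mono hsub)
  · rw [hFK, mul_zero]
    intro h
    exact hy.2 ⟨_, h, (extChartAt (𝓡∂ n) i).right_inv hy.1⟩

omit [IsManifold (𝓡∂ n) ∞ M] [CompactSpace M] [T2Space M] in
theorem chartIntegral_sum (hvol : IsSmooth vol) {ι : Type*} (s : Finset ι) {i : M} {F : ι → M → ℝ}
    (hF : ∀ a ∈ s, Continuous (F a)) {K : Set M} (hK : IsCompact K)
    (hKi : K ⊆ (chartAt (EuclideanHalfSpace n) i).source)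
    (hFK : ∀ a ∈ s, ∀ x, x ∉ K → F a x = 0) :
    chartIntegral vol i (fun x => ∑ a ∈ s, F a x) = ∑ a ∈ s, chartIntegral vol i (F a) := by
  simp only [chartIntegral, Finset.mul_sum]
  exact integral_finsetSum s fun a ha => integrableOn_chartIntegral hvol (hF a ha) hK hKi (hFK a ha)

variable (n M) in
theorem finite_chartPartition : {i : M | ∃ x, chartPartition n M i x ≠ 0}.Finite := by
  have h := (chartPartition n M).locallyFinite.finite_nonempty_of_compact
  exact h

variable (n M) in
/-- The finitely many indices for which the function of the partition of unity is not zero. -/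
noncomputable def partitionIndices : Finset M := (finite_chartPartition n M).toFinset

theorem chartPartition_eq_zero {i : M} (hi : i ∉ partitionIndices n M) (x : M) :
    chartPartition n M i x = 0 := by
  by_contra h
  exact hi ((finite_chartPartition n M).mem_toFinset.2 ⟨x, h⟩)

theorem sum_chartPartition (x : M) : ∑ i ∈ partitionIndices n M, chartPartition n M i x = 1 := by
  rw [← (chartPartition n M).sum_eq_one (mem_univ x)]
  refine (finsum_eq_sum_of_support_subset _ fun i hi => ?_).symm
  by_contra h
  exact hi (chartPartition_eq_zero h x)

theorem tsupport_chartPartition_subset (i : M) :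
    tsupport (chartPartition n M i) ⊆ (chartAt (EuclideanHalfSpace n) i).source :=
  (SmoothPartitionOfUnity.exists_isSubordinate_chartAt_source (𝓡∂ n) M).choose_spec i

theorem isCompact_tsupport_chartPartition (i : M) :
    IsCompact (tsupport (chartPartition n M i)) :=
  (isClosed_tsupport _).isCompact

theorem chartPartition_mul_eq_zero {i x : M} (hx : x ∉ tsupport (chartPartition n M i)) (c : ℝ) :
    chartPartition n M i x * c = 0 := by
  rw [image_eq_zero_of_notMem_tsupport hx, zero_mul]

/-- The integral against the measure defined by the volume form, computed by means of the
partition of unity. -/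
noncomputable def volIntegral (vol : DForm n M n) (F : M → ℝ) : ℝ :=
  ∑ i ∈ partitionIndices n M, chartIntegral vol i fun x => chartPartition n M i x * F x

/-- Since `α` is a multiple of `vol`, the sign in the definition of the integral turns the
coefficient of `vol` into its absolute value. -/
theorem integral_eq_volIntegral (hvol : IsVolumeForm vol) (α : DForm n M n) :
    integral vol α = volIntegral vol (ratio vol α) := by
  have h : ∀ i : M, ∫ y in (extChartAt (𝓡∂ n) i).target,
      chartPartition n M i ((extChartAt (𝓡∂ n) i).symm y) *
        (Real.sign (coeff vol i y) * coeff α i y) =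
      chartIntegral vol i fun x => chartPartition n M i x * ratio vol α x := by
    intro i
    refine integral_congr_ae (Filter.Eventually.of_forall fun y => ?_)
    simp only [coeff_eq_ratio hvol α, ← sign_mul_self_eq_abs]
    ring
  rw [integral, volIntegral]
  simp only [h]
  refine finsum_eq_sum_of_support_subset _ fun i hi => ?_
  by_contra h'
  refine hi ?_
  simp [chartIntegral, chartPartition_eq_zero h']

theorem continuous_chartPartition (i : M) : Continuous (chartPartition n M i) :=
  (chartPartition n M i).contMDiff.continuous

/-- Invariance of the measure under volume-preserving diffeomorphisms: compare the partition of
unity with its translate on the overlaps of charts. -/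
theorem volIntegral_comp (hvol : IsVolumeForm vol) (g : DiffGroup n M)
    (hg : pullback (toMap g) vol = vol) {F : M → ℝ} (hF : Continuous F) :
    volIntegral vol (fun x => F (toMap g x)) = volIntegral vol F := by
  have hgc : Continuous (toMap g) := g.2.1.continuous
  have hgi : Continuous (g : Equiv.Perm M).symm := g.2.2.continuous
  let H : M → M → M → ℝ := fun i j z =>
    chartPartition n M i ((g : Equiv.Perm M).symm z) * (chartPartition n M j z * F z)
  have hH : ∀ i j x, H i j (toMap g x) =
      chartPartition n M i x * (chartPartition n M j (toMap g x) * F (toMap g x)) := fun i j x => by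
    simp only [H, toMap, Equiv.symm_apply_apply]
  have hc : ∀ i j, Continuous (H i j) := fun i j =>
    ((continuous_chartPartition i).comp hgi).mul ((continuous_chartPartition j).mul hF)
  have e1 : ∀ i, chartIntegral vol i (fun x => chartPartition n M i x * F (toMap g x)) =
      ∑ j ∈ partitionIndices n M, chartIntegral vol i (fun x => H i j (toMap g x)) := fun i => by
    rw [← chartIntegral_sum hvol.1 _ (F := fun j x => H i j (toMap g x))
      (fun j _ => (hc i j).comp hgc)
      (isCompact_tsupport_chartPartition i) (tsupport_chartPartition_subset i)
      fun j _ x hx => by rw [hH, chartPartition_mul_eq_zero hx]]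
    congr 1
    funext x
    simp only [hH, ← Finset.mul_sum, ← Finset.sum_mul, sum_chartPartition, one_mul]
  have e2 : ∀ j, chartIntegral vol j (fun x => chartPartition n M j x * F x) =
      ∑ i ∈ partitionIndices n M, chartIntegral vol j (H i j) := fun j => by
    rw [← chartIntegral_sum hvol.1 _ (fun i _ => hc i j)
      (isCompact_tsupport_chartPartition j) (tsupport_chartPartition_subset j)
      fun i _ x hx => by simp only [H]; rw [chartPartition_mul_eq_zero hx, mul_zero]]
    congr 1
    funext x
    simp only [H, ← Finset.sum_mul, sum_chartPartition, one_mul]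
  simp only [volIntegral, e1, e2]
  rw [Finset.sum_comm]
  refine Finset.sum_congr rfl fun j _ => Finset.sum_congr rfl fun i _ => ?_
  refine chartIntegral_comp g hg i j (H i j) fun x hx => ?_
  rw [hH] at hx
  simp only [extChartAt_source]
  exact ⟨tsupport_chartPartition_subset i (subset_tsupport _ (left_ne_zero_of_mul hx)),
    tsupport_chartPartition_subset j (subset_tsupport _
      (left_ne_zero_of_mul (right_ne_zero_of_mul hx)))⟩

/-- A function supported in a chart domain can be integrated in that chart. -/
theorem volIntegral_eq_chartIntegral (hvol : IsVolumeForm vol) {F : M → ℝ} (hF : Continuous F)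
    {k : M} {K : Set M} (hK : IsCompact K)
    (hKk : K ⊆ (chartAt (EuclideanHalfSpace n) k).source) (hFK : ∀ x, x ∉ K → F x = 0) :
    volIntegral vol F = chartIntegral vol k F := by
  have h1 : ∀ i, chartIntegral vol i (fun x => chartPartition n M i x * F x) =
      chartIntegral vol k (fun x => chartPartition n M i x * F x) := fun i => by
    refine chartIntegral_comp 1 (pullback_one vol) i k
      (fun x => chartPartition n M i x * F x) fun x hx => ?_
    change chartPartition n M i x * F x ≠ 0 at hx
    change x ∈ _ ∧ x ∈ _
    simp only [extChartAt_source]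
    refine ⟨tsupport_chartPartition_subset i (subset_tsupport _ (left_ne_zero_of_mul hx)), hKk ?_⟩
    by_contra h
    exact right_ne_zero_of_mul hx (hFK x h)
  simp only [volIntegral, h1]
  rw [← chartIntegral_sum hvol.1 _ (F := fun i x => chartPartition n M i x * F x)
    (fun i _ => (continuous_chartPartition i).mul hF) hK hKk
    fun i _ x hx => by rw [hFK x hx, mul_zero]]
  simp only [← Finset.sum_mul, sum_chartPartition, one_mul]

/-- The integral is invariant under diffeomorphisms which preserve the volume form. -/
theorem integral_pullback (hvol : IsVolumeForm vol) (g : DiffGroup n M)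
    (hg : pullback (toMap g) vol = vol) {α : DForm n M n} (hα : IsSmooth α) :
    integral vol (pullback (toMap g) α) = integral vol α := by
  rw [integral_eq_volIntegral hvol, integral_eq_volIntegral hvol,
    ← volIntegral_comp hvol g hg (continuous_ratio hvol hα)]
  congr 1
  funext x
  refine ratio_eq_of_eq hvol ?_
  have h1 : formAt (pullback (toMap g) α) x = (formAt α (toMap g x)).compContinuousLinearMap
    (mfderiv (𝓡∂ n) (𝓡∂ n) (toMap g) x : Eucl n →L[ℝ] Eucl n) := rfl
  have h2 : formAt vol x = (formAt vol (toMap g x)).compContinuousLinearMap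
    (mfderiv (𝓡∂ n) (𝓡∂ n) (toMap g) x : Eucl n →L[ℝ] Eucl n) :=
      (congrArg (fun a => formAt a x) hg).symm
  rw [h1, formAt_eq_ratio hvol α, h2]
  rfl

theorem integral_sum (hvol : IsVolumeForm vol) {ι : Type*} (s : Finset ι) {α : ι → DForm n M n}
    (hα : ∀ a ∈ s, IsSmooth (α a)) :
    integral vol (∑ a ∈ s, α a) = ∑ a ∈ s, integral vol (α a) := by
  simp only [integral_eq_volIntegral hvol, volIntegral]
  rw [Finset.sum_comm]
  refine Finset.sum_congr rfl fun i _ => ?_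
  rw [← chartIntegral_sum hvol.1 s (F := fun a x => chartPartition n M i x * ratio vol (α a) x)
    (fun a ha => (continuous_chartPartition i).mul (continuous_ratio hvol (hα a ha)))
    (isCompact_tsupport_chartPartition i) (tsupport_chartPartition_subset i)
    fun a _ x hx => chartPartition_mul_eq_zero hx _]
  congr 1
  funext x
  rw [← Finset.mul_sum]
  congr 1
  refine ratio_eq_of_eq hvol ?_
  rw [Finset.sum_smul, ← Finset.sum_congr rfl fun a _ => formAt_eq_ratio hvol (α a) x]
  exact Finset.sum_apply x s α

theorem integral_smul (hvol : IsVolumeForm vol) (c : ℝ) (α : DForm n M n) :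
    integral vol (c • α) = c * integral vol α := by
  have h : ∀ x, ratio vol (c • α) x = c * ratio vol α x := fun x => by
    refine ratio_eq_of_eq hvol ?_
    rw [mul_smul, ← formAt_eq_ratio hvol]
    rfl
  simp only [integral_eq_volIntegral hvol, volIntegral, chartIntegral, h, Finset.mul_sum,
    ← integral_const_mul, mul_left_comm _ c]

theorem integral_zsmul (hvol : IsVolumeForm vol) (c : ℤ) (α : DForm n M n) :
    integral vol (c • α) = c • integral vol α := by
  rw [← Int.cast_smul_eq_zsmul ℝ, integral_smul hvol, zsmul_eq_mul]

theorem integral_add (hvol : IsVolumeForm vol) {α β : DForm n M n} (hα : IsSmooth α)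
    (hβ : IsSmooth β) : integral vol (α + β) = integral vol α + integral vol β := by
  have h := integral_sum hvol (Finset.univ : Finset (Fin 2)) (α := ![α, β])
    (fun a _ => by fin_cases a <;> assumption)
  simpa using h

end Integral

/-! ### Stokes' theorem on the half-space -/

section HalfSpace

open MeasureTheory Set

variable {l : ℕ} [NeZero (l + 1)]

theorem mem_range_iff {n : ℕ} [NeZero n] {y : Eucl n} : y ∈ range (𝓡∂ n) ↔ 0 ≤ y 0 := by
  rw [range_modelWithCornersEuclideanHalfSpace]; rfl

omit [NeZero (l + 1)] in
theorem topCoeff_extDerivWithin {γ : Eucl (l + 1) → (Eucl (l + 1)) [⋀^Fin l]→L[ℝ] ℝ}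
    {R : Set (Eucl (l + 1))} {y : Eucl (l + 1)} (hγ : DifferentiableWithinAt ℝ γ R y)
    (hR : UniqueDiffWithinAt ℝ R y) :
    topCoeff (extDerivWithin γ R y) = ∑ i : Fin (l + 1), (-1 : ℤ) ^ (i : ℕ) •
      fderivWithin ℝ (fun z => γ z (i.removeNth fun j => EuclideanSpace.single j (1 : ℝ))) R y
        (EuclideanSpace.single i 1) :=
  extDerivWithin_apply hγ hR _

/-- Stokes' theorem on the half-space: the integral of `dγ` vanishes for a compactly supported form
`γ` whose pullback to the boundary hyperplane is zero. -/
theorem integral_extDerivWithin_halfSpace {γ : Eucl (l + 1) → (Eucl (l + 1)) [⋀^Fin l]→L[ℝ] ℝ}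
    (hγ : ContDiffOn ℝ 1 γ (range (𝓡∂ (l + 1)))) {K : Set (Eucl (l + 1))} (hK : IsCompact K)
    (hγK : ∀ y, y ∉ K → γ y = 0)
    (hbd : ∀ y : Eucl (l + 1), y 0 = 0 → ∀ v : Fin l → Eucl (l + 1), (∀ i, v i 0 = 0) → γ y v = 0) :
    ∫ y in range (𝓡∂ (l + 1)), topCoeff (extDerivWithin γ (range (𝓡∂ (l + 1))) y) = 0 := by
  set R := range (𝓡∂ (l + 1)) with hR
  have hRu : UniqueDiffOn ℝ R := (𝓡∂ (l + 1)).uniqueDiffOn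
  have hB : ∃ B : ℝ, 0 < B ∧ ∀ y ∈ K, ‖y‖ < B := by
    obtain ⟨B, hB⟩ := Bornology.IsBounded.exists_norm_le hK.isBounded
    exact ⟨max B 0 + 1, by positivity, fun y hy => lt_of_le_of_lt (hB y hy)
      (lt_of_le_of_lt (le_max_left _ _) (lt_add_one _))⟩
  obtain ⟨B, hB0, hBK⟩ := hB
  let e : Fin (l + 1) → Eucl (l + 1) := fun j => EuclideanSpace.single j (1 : ℝ)
  let L : (Fin (l + 1) → ℝ) →L[ℝ] Eucl (l + 1) :=
    (PiLp.continuousLinearEquiv 2 ℝ fun _ : Fin (l + 1) => ℝ).symm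
  have hL : ∀ z i, (L z) i = z i := fun z i => rfl
  let a : Fin (l + 1) → ℝ := fun i => if i = 0 then 0 else -B
  let b : Fin (l + 1) → ℝ := fun _ => B
  have hab : a ≤ b := fun i => by simp only [a, b]; split_ifs <;> linarith
  have hLR : ∀ z ∈ Icc a b, L z ∈ R := fun z hz => by
    rw [hR, mem_range_iff, hL]
    simpa [a] using hz.1 0
  let q : Fin (l + 1) → Eucl (l + 1) → ℝ := fun i y => γ y (i.removeNth e)
  have hq : ∀ i, ContDiffOn ℝ 1 (q i) R := fun i =>
    (ContinuousAlternatingMap.apply ℝ (Eucl (l + 1)) ℝ (i.removeNth e)).contDiff.comp_contDiffOn hγ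
  -- The vector field whose divergence is the coefficient of `dγ`; the box `[a, b]` has one face on
  -- the boundary hyperplane, and on its other faces `γ` is zero.
  let f : Fin (l + 1) → (Fin (l + 1) → ℝ) → ℝ := fun i z => (-1) ^ (i : ℕ) * q i (L z)
  let f' : Fin (l + 1) → (Fin (l + 1) → ℝ) → (Fin (l + 1) → ℝ) →L[ℝ] ℝ := fun i z =>
    (-1 : ℝ) ^ (i : ℕ) • (fderivWithin ℝ (q i) R (L z)).comp L
  have hLc : Continuous L := L.continuous
  have hf : ∀ i, ContinuousOn (f i) (Icc a b) := fun i =>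
    continuousOn_const.mul ((hq i).continuousOn.comp hLc.continuousOn hLR)
  have hf' : ∀ i, ContinuousOn (f' i) (Icc a b) := fun i => by
    have h1 := ((hq i).continuousOn_fderivWithin hRu le_rfl).comp hLc.continuousOn hLR
    exact (h1.clm_comp (continuousOn_const (c := L))).const_smul ((-1 : ℝ) ^ (i : ℕ))
  have hdiv := integral_divergence_of_hasFDerivAt_off_countable' a b hab f f' ∅ countable_empty hf
    (fun z hz i => by
      have hz' := hz.1
      have h0 : 0 < L z 0 := by
        have := (hz' 0 (mem_univ _)).1
        rw [hL]
        simpa [a] using this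
      have hn : R ∈ 𝓝 (L z) := by
        rw [← mem_interior_iff_mem_nhds, hR, interior_range_modelWithCornersEuclideanHalfSpace]
        exact h0
      have h1 : HasFDerivAt (q i) (fderivWithin ℝ (q i) R (L z)) (L z) :=
        (((hq i).differentiableOn (by simp) _ (mem_of_mem_nhds hn)).hasFDerivWithinAt).hasFDerivAt
          hn
      exact (h1.comp z L.hasFDerivAt).const_mul _)
    (by
      refine ContinuousOn.integrableOn_compact isCompact_Icc ?_
      exact continuousOn_finsetSum _ fun i _ => (hf' i).clm_apply continuousOn_const)
  have hout : ∀ y : Eucl (l + 1), ∀ i, B ≤ |y i| → γ y = 0 := fun y i h => by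
    refine hγK y fun hy => absurd (hBK y hy) (not_lt.2 (h.trans ?_))
    simpa using PiLp.norm_apply_le y i
  have hfront : ∀ i x, f i (Fin.insertNth i (b i) x) = 0 := fun i x => by
    have : γ (L (Fin.insertNth i (b i) x)) = 0 := hout _ i (by rw [hL]; simp [b, le_abs_self])
    simp only [f, q, this]
    simp
  have hback : ∀ i x, f i (Fin.insertNth i (a i) x) = 0 := fun i x => by
    have : γ (L (Fin.insertNth i (a i) x)) (i.removeNth e) = 0 := by
      by_cases hi : i = 0
      · subst hi
        refine hbd _ ?_ _ fun j => ?_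
        · rw [hL]; simp [a]
        · simp [e, Fin.removeNth]
      · rw [hout _ i (by rw [hL]; simp [a, hi, le_abs_self])]
        rfl
    simp only [f, q, this]
    simp
  simp only [hfront, hback, integral_zero, sub_zero, Finset.sum_const_zero] at hdiv
  let D : Eucl (l + 1) → ℝ := fun y => topCoeff (extDerivWithin γ R y)
  have hD0 : ∀ y ∈ R, y ∉ K → D y = 0 := fun y hyR hy => by
    have h1 : γ =ᶠ[𝓝[R] y] fun _ => 0 := by
      filter_upwards [mem_nhdsWithin_of_mem_nhds (hK.isClosed.isOpen_compl.mem_nhds hy)] with z hz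
      exact hγK z hz
    have h2 : extDerivWithin γ R y = 0 := by
      rw [h1.extDerivWithin_eq_of_mem hyR, extDerivWithin, fderivWithin_const_apply]
      exact map_zero (ContinuousAlternatingMap.alternatizeUncurryFinCLM ℝ (Eucl (l + 1)) ℝ)
    simp only [D, h2]
    rfl
  have hsub : (WithLp.ofLp : Eucl (l + 1) → Fin (l + 1) → ℝ) ⁻¹' Icc a b ⊆ R := fun y hy => hLR _ hy
  change ∫ y in R, D y = 0
  rw [setIntegral_eq_of_subset_of_forall_sdiff_eq_zero
    (𝓡∂ (l + 1)).isClosed_range.measurableSet hsub (fun y hy => hD0 y hy.1 fun hyK => hy.2 ?_)]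
  · have hmp := (PiLp.volume_preserving_ofLp (Fin (l + 1))).setIntegral_preimage_emb
      (MeasurableEquiv.toLp 2 (Fin (l + 1) → ℝ)).symm.measurableEmbedding
      (fun z => D (L z)) (Icc a b)
    change ∫ y in _, D y = _ at hmp
    rw [hmp, ← hdiv]
    refine setIntegral_congr_fun measurableSet_Icc fun z hz => ?_
    change topCoeff (extDerivWithin γ R (L z)) = _
    rw [topCoeff_extDerivWithin (hγ.differentiableOn (by simp) _ (hLR z hz)) (hRu _ (hLR z hz))]
    refine Finset.sum_congr rfl fun i _ => ?_
    simp only [f', zsmul_eq_mul, smul_apply, smul_eq_mul,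
      ContinuousLinearMap.comp_apply]
    push_cast
    rfl
  · have h1 := hBK y hyK
    have h2 : ∀ i, |y i| ≤ B := fun i => by
      have := PiLp.norm_apply_le y i
      rw [Real.norm_eq_abs] at this
      linarith
    refine ⟨fun i => ?_, fun i => (abs_le.1 (h2 i)).2⟩
    by_cases hi : i = 0
    · subst hi
      simpa [a] using mem_range_iff.1 hy.1
    · simpa [a, hi] using (abs_le.1 (h2 i)).1

end HalfSpace

/-! ### Forms which vanish on the boundary, in charts -/

section Boundary

open MeasureTheory Set

variable {n : ℕ} [NeZero n] {M : Type*} [TopologicalSpace M]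
  [ChartedSpace (EuclideanHalfSpace n) M] [IsManifold (𝓡∂ n) ∞ M]

/-- The boundary can be recognized in any chart, as charts map it to the boundary hyperplane. -/
theorem mem_boundary_iff {k x : M} (hx : x ∈ (chartAt (EuclideanHalfSpace n) k).source) :
    x ∈ (𝓡∂ n).boundary M ↔ extChartAt (𝓡∂ n) k x 0 = 0 := by
  have h := ModelWithCorners.isInteriorPoint_iff_of_mem_atlas (I := 𝓡∂ n) (M := M) (n := ∞)
    (by simp) (chart_mem_atlas (EuclideanHalfSpace n) k) hx
  have h0 : extChartAt (𝓡∂ n) k x ∈ range (𝓡∂ n) :=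
    extChartAt_target_subset_range k ((extChartAt (𝓡∂ n) k).map_source (by simpa using hx))
  rw [mem_range_iff] at h0
  have h1 : (𝓡∂ n).IsInteriorPoint x ↔ 0 < extChartAt (𝓡∂ n) k x 0 := by
    rw [h]
    constructor
    · intro h2
      have h3 := OpenPartialHomeomorph.interior_extend_target_subset_interior_range _ h2
      rw [interior_range_modelWithCornersEuclideanHalfSpace] at h3
      exact h3
    · intro h2
      refine (chartAt (EuclideanHalfSpace n) k).mem_interior_extend_target
        ((chartAt (EuclideanHalfSpace n) k).map_source hx) ?_
      rw [interior_range_modelWithCornersEuclideanHalfSpace]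
      exact h2
  change (𝓡∂ n).IsBoundaryPoint x ↔ _
  rw [ModelWithCorners.isBoundaryPoint_iff_not_isInteriorPoint, h1]
  constructor
  · intro h2; linarith
  · intro h2; rw [h2]; exact lt_irrefl _

/-- Transition maps send tangent vectors of the boundary to tangent vectors of the boundary. -/
theorem fderivWithin_chartMap_apply_zero {k x : M} {y : Eucl n}
    (hy : y ∈ (extChartAt (𝓡∂ n) k).target) (hy0 : y 0 = 0)
    (hx : (extChartAt (𝓡∂ n) k).symm y ∈ (extChartAt (𝓡∂ n) x).source) {v : Eucl n}
    (hv : v 0 = 0) :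
    (fderivWithin ℝ (chartMap id k x) (range (𝓡∂ n)) y v) 0 = 0 := by
  have hd := (contDiffWithinAt_chartMap (f := id) contMDiff_id hy hx).differentiableWithinAt
    (by simp) |>.hasFDerivWithinAt
  let p : ℝ → Eucl n := fun t => y + t • v
  have hp0 : ∀ t, p t 0 = 0 := fun t => by simp [p, hy0, hv]
  have hpR : ∀ t, p t ∈ range (𝓡∂ n) := fun t => mem_range_iff.2 (hp0 t).ge
  have hpd : HasDerivAt p v 0 := by
    simpa [p] using ((hasDerivAt_id (0 : ℝ)).smul_const v).const_add y
  have hpy : y = p 0 := by simp [p]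
  have h1 := hd.comp_hasDerivAt_of_eq 0 hpd (Filter.Eventually.of_forall hpR) hpy
  have h2 : HasDerivAt (fun t => chartMap id k x (p t) 0)
      ((fderivWithin ℝ (chartMap id k x) (range (𝓡∂ n)) y v) 0) 0 :=
    (EuclideanSpace.proj (𝕜 := ℝ) (0 : Fin n)).hasFDerivAt.comp_hasDerivAt 0 h1
  have htend : Filter.Tendsto p (𝓝 0) (𝓝[range (𝓡∂ n)] y) := by
    rw [hpy]
    exact tendsto_nhdsWithin_iff.2 ⟨hpd.continuousAt, Filter.Eventually.of_forall hpR⟩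
  have h3 : (fun t => chartMap id k x (p t) 0) =ᶠ[𝓝 0] fun _ => 0 := by
    filter_upwards [htend.eventually (eventually_mem_source (f := id) contMDiff_id hy hx)] with t ht
    have hs : (extChartAt (𝓡∂ n) k).symm (p t) ∈ (chartAt (EuclideanHalfSpace n) k).source := by
      have := (extChartAt (𝓡∂ n) k).map_target ht.1
      rwa [extChartAt_source] at this
    have hb := (mem_boundary_iff hs).2 (by rw [(extChartAt (𝓡∂ n) k).right_inv ht.1]; exact hp0 t)
    refine (mem_boundary_iff (k := x) ?_).1 hb
    have := ht.2
    rwa [extChartAt_source] at this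
  exact h2.unique ((hasDerivAt_const (0 : ℝ) (0 : ℝ)).congr_of_eventuallyEq h3)

/-- In any chart, a form whose pullback to `∂M` is zero vanishes on vectors tangent to the boundary
hyperplane. The definition of `VanishesOnBoundary` uses only the chart at the point itself. -/
theorem chartRep_apply_eq_zero {l : ℕ} {β : DForm n M l} (hβ : VanishesOnBoundary β) {k : M}
    {y : Eucl n} (hy : y ∈ (extChartAt (𝓡∂ n) k).target) (hy0 : y 0 = 0) {v : Fin l → Eucl n}
    (hv : ∀ i, v i 0 = 0) : chartRep β k y v = 0 := by
  have hs := (extChartAt (𝓡∂ n) k).map_target hy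
  have hyR : y ∈ Set.range (𝓡∂ n) := extChartAt_target_subset_range k hy
  have hu : UniqueMDiffWithinAt 𝓘(ℝ, Eucl n) (Set.range (𝓡∂ n)) y := (𝓡∂ n).uniqueMDiffOn y hyR
  have hb : (extChartAt (𝓡∂ n) k).symm y ∈ (𝓡∂ n).boundary M := by
    rw [mem_boundary_iff (k := k) (by rwa [extChartAt_source] at hs),
      (extChartAt (𝓡∂ n) k).right_inv hy]
    exact hy0
  refine hβ _ hb _ fun i => ?_
  have hs0 := (contMDiffWithinAt_symm hy).mdifferentiableWithinAt (by simp)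
  have hm : MDifferentiableAt (𝓡∂ n) 𝓘(ℝ, Eucl n)
      (extChartAt (𝓡∂ n) ((extChartAt (𝓡∂ n) k).symm y))
      ((extChartAt (𝓡∂ n) k).symm y) := mdifferentiableAt_extChartAt (mem_chart_source _ _)
  have e2 := mfderiv_comp_mfderivWithin (I := 𝓘(ℝ, Eucl n)) (I' := 𝓡∂ n)
    (I'' := 𝓘(ℝ, Eucl n)) y hm hs0 hu
  rw [mfderivWithin_eq_fderivWithin] at e2
  have h0 := fderivWithin_chartMap_apply_zero hy hy0
    (mem_extChartAt_source (I := 𝓡∂ n) ((extChartAt (𝓡∂ n) k).symm y)) (hv i)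
  have e3 : fderivWithin ℝ (chartMap id k ((extChartAt (𝓡∂ n) k).symm y))
    (Set.range (𝓡∂ n)) y = _ := e2
  rw [e3] at h0
  exact h0

end Boundary

/-! ### Stokes' theorem on the manifold -/

section SmoothForms

open Set

variable {n : ℕ} [NeZero n] {M : Type*} [TopologicalSpace M]
  [ChartedSpace (EuclideanHalfSpace n) M] {l : ℕ}

theorem isSmooth_zero : IsSmooth (0 : DForm n M l) := fun x₀ => by
  have : chartRep (0 : DForm n M l) x₀ = fun _ => 0 := by funext y; ext v; rfl
  rw [this]
  exact contDiffOn_const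

theorem chartRep_add (α β : DForm n M l) (x₀ : M) :
    chartRep (α + β) x₀ = chartRep α x₀ + chartRep β x₀ := by funext y; ext v; rfl

theorem chartRep_smul (c : ℝ) (α : DForm n M l) (x₀ : M) :
    chartRep (c • α) x₀ = c • chartRep α x₀ := by funext y; ext v; rfl

theorem isSmooth_add {α β : DForm n M l} (hα : IsSmooth α) (hβ : IsSmooth β) :
    IsSmooth (α + β) := fun x₀ => by
  rw [chartRep_add]
  exact (hα x₀).add (hβ x₀)

theorem isSmooth_smul (c : ℝ) {α : DForm n M l} (hα : IsSmooth α) : IsSmooth (c • α) :=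
  fun x₀ => by
    rw [chartRep_smul]
    exact (hα x₀).const_smul c

theorem isSmooth_zsmul (c : ℤ) {α : DForm n M l} (hα : IsSmooth α) : IsSmooth (c • α) := by
  rw [← Int.cast_smul_eq_zsmul ℝ]
  exact isSmooth_smul _ hα

theorem isSmooth_sum {ι : Type*} (s : Finset ι) {α : ι → DForm n M l}
    (hα : ∀ a ∈ s, IsSmooth (α a)) : IsSmooth (∑ a ∈ s, α a) :=
  Finset.sum_induction _ IsSmooth (fun _ _ => isSmooth_add) isSmooth_zero hα

theorem differentiableWithinAt_chartRep {α : DForm n M l} (hα : IsSmooth α) {x₀ : M} {y : Eucl n}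
    (hy : y ∈ (extChartAt (𝓡∂ n) x₀).target) :
    DifferentiableWithinAt ℝ (chartRep α x₀) (range (𝓡∂ n)) y :=
  ((hα x₀).differentiableOn (by simp) _ hy).mono_of_mem_nhdsWithin (target_mem_nhdsWithin hy)

variable [IsManifold (𝓡∂ n) ∞ M]

theorem dForm_zero : dForm (0 : DForm n M l) = 0 := by
  refine dForm_ext fun x => ?_
  rw [chartRep_dForm isSmooth_zero (mem_extChartAt_target x)]
  have : chartRep (0 : DForm n M l) x = fun _ => 0 := by funext y; ext v; rfl
  rw [this, extDerivWithin, fderivWithin_const_apply]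
  exact map_zero (ContinuousAlternatingMap.alternatizeUncurryFinCLM ℝ (Eucl n) ℝ)

theorem dForm_add {α β : DForm n M l} (hα : IsSmooth α) (hβ : IsSmooth β) :
    dForm (α + β) = dForm α + dForm β := by
  refine dForm_ext fun x => ?_
  have hy := mem_extChartAt_target (I := 𝓡∂ n) x
  rw [chartRep_dForm (isSmooth_add hα hβ) hy, chartRep_add, chartRep_add, Pi.add_apply,
    chartRep_dForm hα hy, chartRep_dForm hβ hy, extDerivWithin_add
      ((𝓡∂ n).uniqueDiffOn _ (extChartAt_target_subset_range x hy))
      (differentiableWithinAt_chartRep hα hy) (differentiableWithinAt_chartRep hβ hy)]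

theorem dForm_sum {ι : Type*} (s : Finset ι) {α : ι → DForm n M l}
    (hα : ∀ a ∈ s, IsSmooth (α a)) : dForm (∑ a ∈ s, α a) = ∑ a ∈ s, dForm (α a) := by
  classical
  induction s using Finset.induction_on with
  | empty => simpa using dForm_zero
  | insert a s ha ih =>
    have hs : ∀ b ∈ s, IsSmooth (α b) := fun b hb => hα b (Finset.mem_insert_of_mem hb)
    rw [Finset.sum_insert ha, Finset.sum_insert ha,
      dForm_add (hα a (Finset.mem_insert_self a s)) (isSmooth_sum s hs), ih hs]

/-- The product of a function and a form. -/
noncomputable def mulForm (f : M → ℝ) (α : DForm n M l) : DForm n M l := fun x => f x • α x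

theorem isSmooth_mulForm {f : M → ℝ} (hf : ContMDiff (𝓡∂ n) 𝓘(ℝ, ℝ) ∞ f) {α : DForm n M l}
    (hα : IsSmooth α) : IsSmooth (mulForm f α) := fun x₀ => by
  have h1 : ContDiffOn ℝ ∞ (fun y => f ((extChartAt (𝓡∂ n) x₀).symm y))
      (extChartAt (𝓡∂ n) x₀).target := by
    rw [← contMDiffOn_iff_contDiffOn]
    exact hf.comp_contMDiffOn (contMDiffOn_extChartAt_symm x₀)
  exact h1.smul (hα x₀)

omit [IsManifold (𝓡∂ n) ∞ M] in
theorem vanishesOnBoundary_mulForm (f : M → ℝ) {α : DForm n M l} (hα : VanishesOnBoundary α) :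
    VanishesOnBoundary (mulForm f α) := fun x hx v hv => by
  change f x * α x v = 0
  rw [hα x hx v hv, mul_zero]

/-- Off the support of a form its differential vanishes. -/
theorem dForm_eq_zero_of_notMem {α : DForm n M l} (hα : IsSmooth α) {K : Set M} (hK : IsClosed K)
    (hαK : ∀ x, x ∉ K → formAt α x = 0) {x : M} (hx : x ∉ K) : formAt (dForm α) x = 0 := by
  have hy := mem_extChartAt_target (I := 𝓡∂ n) x
  have hyR := extChartAt_target_subset_range x hy
  have h1 : chartRep α x =ᶠ[𝓝[range (𝓡∂ n)] (extChartAt (𝓡∂ n) x x)] fun _ => 0 := by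
    have hc := (contMDiffWithinAt_symm hy).continuousWithinAt
    have hn : Kᶜ ∈ 𝓝 ((extChartAt (𝓡∂ n) x).symm (extChartAt (𝓡∂ n) x x)) := by
      rw [extChartAt_to_inv]
      exact hK.isOpen_compl.mem_nhds hx
    filter_upwards [hc.preimage_mem_nhdsWithin hn] with z hz
    change (formAt α ((extChartAt (𝓡∂ n) x).symm z)).compContinuousLinearMap _ = 0
    rw [hαK _ hz]
    rfl
  have h2 : chartRep (dForm α) x (extChartAt (𝓡∂ n) x x) = 0 := by
    rw [chartRep_dForm hα hy, h1.extDerivWithin_eq_of_mem hyR, extDerivWithin,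
      fderivWithin_const_apply]
    exact map_zero (ContinuousAlternatingMap.alternatizeUncurryFinCLM ℝ (Eucl n) ℝ)
  rw [formAt_eq (dForm α) (mem_extChartAt_source (I := 𝓡∂ n) x), h2]
  rfl

end SmoothForms

section Stokes

open MeasureTheory Set

variable {l : ℕ} [NeZero (l + 1)] {M : Type*} [TopologicalSpace M]
  [ChartedSpace (EuclideanHalfSpace (l + 1)) M] [IsManifold (𝓡∂ (l + 1)) ∞ M]
  {vol : DForm (l + 1) M (l + 1)}

/-- Stokes' theorem for a form supported in the domain of one chart. -/
theorem setIntegral_sign_mul_coeff_dForm (hvol : IsVolumeForm vol) {β : DForm (l + 1) M l}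
    (hβ : IsSmooth β) (hβ0 : VanishesOnBoundary β) {k : M} {K : Set M} (hK : IsCompact K)
    (hKk : K ⊆ (extChartAt (𝓡∂ (l + 1)) k).source) (hβK : ∀ x, x ∉ K → formAt β x = 0) :
    ∫ y in (extChartAt (𝓡∂ (l + 1)) k).target,
      Real.sign (coeff vol k y) * coeff (dForm β) k y = 0 := by
  classical
  set φ := extChartAt (𝓡∂ (l + 1)) k with hφ
  set R := range (𝓡∂ (l + 1)) with hR
  have hRu : UniqueDiffOn ℝ R := (𝓡∂ (l + 1)).uniqueDiffOn
  have hφR : φ.target ⊆ R := extChartAt_target_subset_range k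
  -- The coordinate expression with the sign of the orientation, extended by zero to the half-space.
  let γ : Eucl (l + 1) → (Eucl (l + 1)) [⋀^Fin l]→L[ℝ] ℝ := fun y =>
    if y ∈ φ.target then Real.sign (coeff vol k y) • chartRep β k y else 0
  have hK1 : IsCompact (φ '' K) := hK.image_of_continuousOn ((continuousOn_extChartAt k).mono hKk)
  have hK1t : φ '' K ⊆ φ.target := image_subset_iff.2 fun x hx => φ.map_source (hKk hx)
  have hγK : ∀ y, y ∉ φ '' K → γ y = 0 := fun y hy => by
    by_cases hyt : y ∈ φ.target
    · have h0 : formAt β (φ.symm y) = 0 := hβK _ fun h => hy ⟨_, h, φ.right_inv hyt⟩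
      have h1 : chartRep β k y = 0 := by
        change (formAt β (φ.symm y)).compContinuousLinearMap _ = 0
        rw [h0]
        rfl
      simp only [γ, h1, smul_zero, ite_self]
    · simp only [γ, hyt, if_false]
  -- The sign of the coefficient of the volume form is locally constant.
  have hγev : ∀ y ∈ φ.target, γ =ᶠ[𝓝[R] y] Real.sign (coeff vol k y) • chartRep β k := by
    intro y hy
    have hc : ContinuousWithinAt (coeff vol k) R y :=
      ((continuousOn_coeff hvol.1 k) y hy).mono_of_mem_nhdsWithin (target_mem_nhdsWithin hy)
    have hs : ∀ᶠ z in 𝓝[R] y, Real.sign (coeff vol k z) = Real.sign (coeff vol k y) := by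
      rcases lt_or_gt_of_ne (coeff_ne_zero hvol hy) with h | h
      · filter_upwards [hc.eventually (gt_mem_nhds h)] with z hz
        rw [Real.sign_of_neg h, Real.sign_of_neg hz]
      · filter_upwards [hc.eventually (lt_mem_nhds h)] with z hz
        rw [Real.sign_of_pos h, Real.sign_of_pos hz]
    filter_upwards [hs, target_mem_nhdsWithin hy] with z hz hzt
    simp only [γ, φ, hzt, if_true, hz, Pi.smul_apply]
  have hγ : ContDiffOn ℝ 1 γ R := by
    intro y hyR
    by_cases hy : y ∈ φ '' K
    · have hyt := hK1t hy
      have h1 : ContDiffWithinAt ℝ 1 (chartRep β k) R y :=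
        (((hβ k) y hyt).mono_of_mem_nhdsWithin (target_mem_nhdsWithin hyt)).of_le (by simp)
      exact (h1.const_smul (Real.sign (coeff vol k y))).congr_of_eventuallyEq_of_mem
        (hγev y hyt) hyR
    · have h1 : γ =ᶠ[𝓝[R] y] fun _ => 0 := by
        filter_upwards [mem_nhdsWithin_of_mem_nhds (hK1.isClosed.isOpen_compl.mem_nhds hy)]
          with z hz
        exact hγK z hz
      exact contDiffWithinAt_const.congr_of_eventuallyEq_of_mem h1 hyR
  have hmain := integral_extDerivWithin_halfSpace hγ hK1 hγK fun y hy0 v hv => by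
    by_cases hyt : y ∈ φ.target
    · simp only [γ, hyt, if_true]
      change _ * chartRep β k y v = 0
      rw [chartRep_apply_eq_zero hβ0 hyt hy0 hv, mul_zero]
    · simp only [γ, hyt, if_false]
      rfl
  rw [← hmain]
  symm
  rw [setIntegral_eq_of_subset_of_forall_sdiff_eq_zero (𝓡∂ (l + 1)).isClosed_range.measurableSet
    hφR fun y hy => ?_]
  · refine setIntegral_congr_fun (measurableSet_extChartAt_target k) fun y hy => ?_
    change topCoeff (extDerivWithin γ R y) = _
    rw [(hγev y hy).extDerivWithin_eq_of_mem (hφR hy), extDerivWithin_smul _ _ (hRu y (hφR hy)),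
      ← chartRep_dForm hβ hy]
    rfl
  · have hyK : y ∉ φ '' K := fun h => hy.2 (hK1t h)
    have h1 : γ =ᶠ[𝓝[R] y] fun _ => 0 := by
      filter_upwards [mem_nhdsWithin_of_mem_nhds (hK1.isClosed.isOpen_compl.mem_nhds hyK)]
        with z hz
      exact hγK z hz
    rw [h1.extDerivWithin_eq_of_mem hy.1, extDerivWithin, fderivWithin_const_apply]
    exact congrArg topCoeff
      (map_zero (ContinuousAlternatingMap.alternatizeUncurryFinCLM ℝ (Eucl (l + 1)) ℝ))

variable [T2Space M] [CompactSpace M]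

/-- Stokes' theorem: the integral of the differential of a form whose pullback to the boundary is
zero vanishes. -/
theorem integral_dForm (hvol : IsVolumeForm vol) {β : DForm (l + 1) M l}
    (hβ : IsSmooth β) (hβ0 : VanishesOnBoundary β) : integral vol (dForm β) = 0 := by
  let ρ := chartPartition (l + 1) M
  have hs : ∀ k, IsSmooth (mulForm (ρ k) β) := fun k => isSmooth_mulForm (ρ k).contMDiff hβ
  have hsum : β = ∑ k ∈ partitionIndices (l + 1) M, mulForm (ρ k) β := by
    funext x
    rw [Finset.sum_apply]
    simp only [mulForm, ρ, ← Finset.sum_smul, sum_chartPartition, one_smul]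
  rw [hsum, dForm_sum _ fun k _ => hs k, integral_sum hvol _ fun k _ => isSmooth_dForm (hs k)]
  refine Finset.sum_eq_zero fun k _ => ?_
  have hK := isCompact_tsupport_chartPartition (n := l + 1) (M := M) k
  have hKk := tsupport_chartPartition_subset (n := l + 1) (M := M) k
  have hβK : ∀ x, x ∉ tsupport (ρ k) → formAt (mulForm (ρ k) β) x = 0 := fun x hx => by
    change ρ k x • formAt β x = 0
    rw [image_eq_zero_of_notMem_tsupport hx, zero_smul]
  rw [integral_eq_volIntegral hvol, volIntegral_eq_chartIntegral hvol
    (continuous_ratio hvol (isSmooth_dForm (hs k))) hK hKk fun x hx => ratio_eq_of_eq hvol (by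
      rw [dForm_eq_zero_of_notMem (hs k) (isClosed_tsupport _) hβK hx, zero_smul])]
  rw [← setIntegral_sign_mul_coeff_dForm hvol (hs k) (vanishesOnBoundary_mulForm _ hβ0) hK
    (by rwa [extChartAt_source]) hβK]
  refine setIntegral_congr_fun (measurableSet_extChartAt_target k) fun y hy => ?_
  simp only [coeff_eq_ratio hvol (dForm (mulForm (ρ k) β)), ← sign_mul_self_eq_abs]
  ring

end Stokes

/-! ### Cochains as functions of sequences, and the Leibniz rule for `δ` -/

section Sequences

variable {G : Type*} [Group G]

/-- The sequence in which the entries at `i` and `i + 1` are replaced by their product. -/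
def contractSeq (i : ℕ) (s : ℕ → G) : ℕ → G := fun j =>
  if j < i then s j else if j = i then s i * s (i + 1) else s (j + 1)

/-- The product of the first `r` entries of a sequence. -/
def seqProd (s : ℕ → G) : ℕ → G
  | 0 => 1
  | r + 1 => seqProd s r * s r

theorem prod_ofFn_eq_seqProd (s : ℕ → G) (r : ℕ) :
    (List.ofFn fun j : Fin r => s j).prod = seqProd s r := by
  induction r with
  | zero => simp [seqProd]
  | succ r ih =>
    rw [List.ofFn_succ', List.concat_eq_append, List.prod_append, seqProd, ← ih]
    simp

theorem seqProd_succ' (s : ℕ → G) (r : ℕ) :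
    seqProd s (r + 1) = s 0 * seqProd (fun j => s (j + 1)) r := by
  induction r with
  | zero => simp [seqProd]
  | succ r ih => rw [seqProd, ih, seqProd, mul_assoc]

theorem seqProd_congr {s t : ℕ → G} {r : ℕ} (h : ∀ j < r, s j = t j) :
    seqProd s r = seqProd t r := by
  induction r with
  | zero => rfl
  | succ r ih =>
    rw [seqProd, seqProd, ih fun j hj => h j (by omega), h r (by omega)]

theorem seqProd_contractSeq (s : ℕ → G) {i r : ℕ} (hi : i < r) :
    seqProd (contractSeq i s) r = seqProd s (r + 1) := by
  induction r with
  | zero => omega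
  | succ r ih =>
    rw [seqProd]
    rcases Nat.lt_succ_iff_lt_or_eq.1 hi with h | h
    · rw [ih h, seqProd.eq_2 s (r + 1)]
      congr 1
      simp [contractSeq, show ¬ r < i by omega, show r ≠ i by omega]
    · subst h
      rw [seqProd_congr (t := s) fun j hj => by simp [contractSeq, hj], seqProd, seqProd, mul_assoc]
      simp [contractSeq]

/-- The coboundary on cochains written as functions of infinite sequences of which only the first
`k` entries matter. -/
def coboundarySeq {V : Type*} [AddCommGroup V] (act : G → V → V) (k : ℕ)
    (C : (ℕ → G) → V) (s : ℕ → G) : V :=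
  C (fun j => s (j + 1)) + ∑ i ∈ Finset.range k, (-1 : ℤ) ^ (i + 1) • C (contractSeq i s) +
    (-1 : ℤ) ^ (k + 1) • act (s k) (C s)

theorem coboundary_eq_coboundarySeq {V : Type*} [AddCommGroup V] (act : G → V → V) {k : ℕ}
    (c : (Fin k → G) → V) (s : ℕ → G) :
    coboundary act c (fun j : Fin (k + 1) => s j) =
      coboundarySeq act k (fun s => c fun j => s j) s := by
  simp only [coboundary, coboundarySeq, Fin.val_succ, Fin.val_castSucc, Fin.val_last,
    ← Fin.sum_univ_eq_sum_range (fun i =>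
      (-1 : ℤ) ^ (i + 1) • c fun j : Fin k => contractSeq i s j)]
  congr 2
  refine Finset.sum_congr rfl fun i _ => ?_
  congr 2
  funext j
  simp only [Fin.contractNth, contractSeq, Fin.val_castSucc, Fin.val_succ]
  split_ifs with h1 h2
  · rfl
  · rw [h2]
  · rfl

end Sequences

section FormHoms

variable {n : ℕ} [NeZero n] {M : Type*} [TopologicalSpace M]
  [ChartedSpace (EuclideanHalfSpace n) M]

/-- The pullback of forms as a homomorphism of groups. -/
noncomputable def pullbackHom (l : ℕ) (f : M → M) : DForm n M l →+ DForm n M l where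
  toFun := pullback f
  map_zero' := by funext x; ext v; rfl
  map_add' α β := by funext x; ext v; rfl

theorem pullbackHom_apply {l : ℕ} (f : M → M) (α : DForm n M l) :
    pullbackHom l f α = pullback f α := rfl

/-- The wedge product of forms as a biadditive map. -/
noncomputable def wedgeHom {q s l : ℕ} (h : q + s = l) :
    DForm n M q →+ DForm n M s →+ DForm n M l :=
  AddMonoidHom.mk' (fun α => AddMonoidHom.mk' (fun β => wedgeForm h α β)
    fun β β' => funext fun x => wedge_add_right h (α x) (β x) (β' x))
    fun α α' => by ext1 β; exact funext fun x => wedge_add_left h (α x) (α' x) (β x)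

theorem wedgeHom_apply {q s l : ℕ} (h : q + s = l) (α : DForm n M q) (β : DForm n M s) :
    wedgeHom h α β = wedgeForm h α β := rfl

end FormHoms

section CupProducts

variable {n : ℕ} [NeZero n] {M : Type*} [TopologicalSpace M]
  [ChartedSpace (EuclideanHalfSpace n) M] {G : Subgroup (DiffGroup n M)}

/-- The action of a group of diffeomorphisms on forms by pullback. -/
noncomputable abbrev actForm (l : ℕ) (g : G) (α : DForm n M l) : DForm n M l :=
  pullback (toMap (g : DiffGroup n M)) α

/-- The wedge product of homogeneous cochains with values in forms, as a function of infinite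
sequences. -/
noncomputable def cupSeq {p r q t l : ℕ} (h : q + t = l) (a : (Fin p → G) → DForm n M q)
    (b : (Fin r → G) → DForm n M t) (s : ℕ → G) : DForm n M l :=
  wedgeForm h (actForm q (seqProd (fun j => s (p + j)) r) (a fun j => s j))
    (b fun j => s (p + j))

theorem cupSeq_eq_wedgeHom {p r q t l : ℕ} (h : q + t = l) (a : (Fin p → G) → DForm n M q)
    (b : (Fin r → G) → DForm n M t) (s : ℕ → G) :
    cupSeq h a b s = wedgeHom h (pullbackHom q (toMap (seqProd (fun j => s (p + j)) r : G).1)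
      (a fun j => s j)) (b fun j => s (p + j)) := rfl

theorem cupSeq_zsmul_left {p r q t l : ℕ} (h : q + t = l) (c : ℤ) (a : (Fin p → G) → DForm n M q)
    (b : (Fin r → G) → DForm n M t) (s : ℕ → G) :
    cupSeq h (c • a) b s = c • cupSeq h a b s := by
  simp only [cupSeq_eq_wedgeHom, Pi.smul_apply, map_zsmul, AddMonoidHom.smul_apply]

theorem cupSeq_zsmul_right {p r q t l : ℕ} (h : q + t = l) (c : ℤ) (a : (Fin p → G) → DForm n M q)
    (b : (Fin r → G) → DForm n M t) (s : ℕ → G) :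
    cupSeq h a (c • b) s = c • cupSeq h a b s := by
  simp only [cupSeq_eq_wedgeHom, Pi.smul_apply, map_zsmul]

/-- `δ` is a graded derivation of the wedge product of cochains, where the sign comes from the
cochain degree only. -/
theorem coboundarySeq_cupSeq {p r q t l : ℕ} (h : q + t = l) (a : (Fin p → G) → DForm n M q)
    (b : (Fin r → G) → DForm n M t) (s : ℕ → G) :
    coboundarySeq (actForm l) (p + r) (cupSeq h a b) s =
      cupSeq h (deltaForm a) b s + (-1 : ℤ) ^ p • cupSeq h a (deltaForm b) s := by
  -- The common building block of all the summands.
  let W (P : G) (α : DForm n M q) (β : DForm n M t) : DForm n M l :=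
    wedgeHom h (pullbackHom q (toMap (P : DiffGroup n M)) α) β
  set u : ℕ → G := fun j => s (p + j) with hu
  set u' : ℕ → G := fun j => s (p + 1 + j) with hu'
  have huu' : (fun j => u (j + 1)) = u' := by funext j; simp only [hu, hu']; congr 1; omega
  have hδa : deltaForm a (fun j : Fin (p + 1) => s j) = a (fun j => s (j + 1)) +
      ∑ i ∈ Finset.range p, (-1 : ℤ) ^ (i + 1) • a (fun j => contractSeq i s j) +
      (-1 : ℤ) ^ (p + 1) • pullbackHom q (toMap (s p : DiffGroup n M)) (a fun j => s j) :=
    coboundary_eq_coboundarySeq _ a s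
  have hδb : deltaForm b (fun j : Fin (r + 1) => u j) = b (fun j => u' j) +
      ∑ i ∈ Finset.range r, (-1 : ℤ) ^ (i + 1) • b (fun j => contractSeq i u j) +
      (-1 : ℤ) ^ (r + 1) • pullbackHom t (toMap (u r : DiffGroup n M)) (b fun j => u j) := by
    have := coboundary_eq_coboundarySeq
      (fun (g : G) α => pullback (toMap (g : DiffGroup n M)) α) b u
    rw [← huu']
    exact this
  have hP : seqProd u (r + 1) = s p * seqProd u' r := by
    rw [seqProd_succ', huu']; rfl
  have hWmul : ∀ (g P : G) (α : DForm n M q) (β : DForm n M t),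
      W P (pullbackHom q (toMap (g : DiffGroup n M)) α) β = W (g * P) α β := fun g P α β => by
    simp only [W, pullbackHom_apply]
    rw [← pullback_mul]
    rfl
  have hWact : ∀ (g P : G) (α : DForm n M q) (β : DForm n M t),
      actForm l g (W P α β) = W (P * g) α (pullbackHom t (toMap (g : DiffGroup n M)) β) :=
    fun g P α β => by
      simp only [W, pullbackHom_apply, actForm, wedgeHom_apply, pullback_wedgeForm]
      rw [← pullback_mul]
      rfl
  have hR1 : cupSeq h (deltaForm a) b s =
      W (seqProd u' r) (a fun j => s (j + 1)) (b fun j => u' j) +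
      ∑ i ∈ Finset.range p, (-1 : ℤ) ^ (i + 1) •
        W (seqProd u' r) (a fun j => contractSeq i s j) (b fun j => u' j) +
      (-1 : ℤ) ^ (p + 1) • W (seqProd u (r + 1)) (a fun j => s j) (b fun j => u' j) := by
    rw [cupSeq_eq_wedgeHom, hδa, hP, ← hWmul]
    simp only [map_add, map_sum, map_zsmul, AddMonoidHom.add_apply, AddMonoidHom.finsetSum_apply,
      AddMonoidHom.smul_apply, W]
    rfl
  have hR2 : cupSeq h a (deltaForm b) s =
      W (seqProd u (r + 1)) (a fun j => s j) (b fun j => u' j) +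
      ∑ i ∈ Finset.range r, (-1 : ℤ) ^ (i + 1) •
        W (seqProd u (r + 1)) (a fun j => s j) (b fun j => contractSeq i u j) +
      (-1 : ℤ) ^ (r + 1) • W (seqProd u (r + 1)) (a fun j => s j)
        (pullbackHom t (toMap (u r : DiffGroup n M)) (b fun j => u j)) := by
    rw [cupSeq_eq_wedgeHom, hδb]
    simp only [map_add, map_sum, map_zsmul, W]
    rfl
  have hL0 : cupSeq h a b (fun j => s (j + 1)) =
      W (seqProd u' r) (a fun j => s (j + 1)) (b fun j => u' j) := by
    have : (fun j => s (p + j + 1)) = u' := by funext j; simp only [hu']; congr 1; omega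
    rw [cupSeq_eq_wedgeHom, this]
    exact congrArg _ (congrArg b (funext fun j => congrFun this j))
  have hL1 : ∀ i ∈ Finset.range p, cupSeq h a b (contractSeq i s) =
      W (seqProd u' r) (a fun j => contractSeq i s j) (b fun j => u' j) := fun i hi => by
    have hi := Finset.mem_range.1 hi
    have : (fun j => contractSeq i s (p + j)) = u' := by
      funext j
      simp only [hu', contractSeq, show ¬ p + j < i by omega, show p + j ≠ i by omega, if_false]
      congr 1; omega
    rw [cupSeq_eq_wedgeHom, this]
    exact congrArg _ (congrArg b (funext fun j => congrFun this j))
  have hL2 : ∀ i ∈ Finset.range r, cupSeq h a b (contractSeq (p + i) s) =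
      W (seqProd u (r + 1)) (a fun j => s j) (b fun j => contractSeq i u j) := fun i hi => by
    have hi := Finset.mem_range.1 hi
    have h1 : (fun j => contractSeq (p + i) s (p + j)) = contractSeq i u := by
      funext j
      simp only [hu, contractSeq, Nat.add_lt_add_iff_left, Nat.add_left_cancel_iff, add_assoc]
    have h2 : (fun j : Fin p => contractSeq (p + i) s j) = fun j : Fin p => s j := by
      funext j
      simp only [contractSeq, show (j : ℕ) < p + i by omega, if_true]
    rw [cupSeq_eq_wedgeHom, h1, h2, seqProd_contractSeq u hi]
    exact congrArg _ (congrArg b (funext fun j => congrFun h1 j))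
  have hL3 : actForm l (s (p + r)) (cupSeq h a b s) = W (seqProd u (r + 1)) (a fun j => s j)
      (pullbackHom t (toMap (u r : DiffGroup n M)) (b fun j => u j)) :=
    hWact (s (p + r)) (seqProd u r) _ _
  rw [coboundarySeq, hL0, Finset.sum_range_add, hL3, hR1, hR2,
    Finset.sum_congr rfl fun i hi => congrArg _ (hL1 i hi),
    Finset.sum_congr rfl fun i hi => congrArg ((-1 : ℤ) ^ (p + i + 1) • ·) (hL2 i hi)]
  simp only [smul_add, Finset.smul_sum, smul_smul, ← pow_add, add_assoc]
  rw [pow_succ (-1 : ℤ) p]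
  simp only [mul_neg, mul_one, neg_smul]
  abel

end CupProducts

/-! ### Volume-preserving diffeomorphisms and integration of cochains -/

section Groups

variable {n : ℕ} [NeZero n] {M : Type*} [TopologicalSpace M]
  [ChartedSpace (EuclideanHalfSpace n) M]

theorem identityComponent_le (H : Subgroup (DiffGroup n M)) : identityComponent H ≤ H :=
  (Subgroup.closure_le H).2
    (@connectedComponentIn_subset (DiffGroup n M) (smoothTopology n M) (H : Set _) 1)

theorem pullback_vol {vol : DForm n M n} (g : DiffVolRel vol) :
    pullback (toMap (g : DiffGroup n M)) vol = vol :=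
  identityComponent_le _ (identityComponent_le _ g.2).1

theorem toMap_eq_of_mem_boundary {vol : DForm n M n} (g : DiffVolRel vol) {x : M}
    (hx : x ∈ (𝓡∂ n).boundary M) : toMap (g : DiffGroup n M) x = x :=
  (mem_fixingSubgroup_iff (DiffGroup n M)).1 (identityComponent_le _ g.2).2 x hx

theorem vanishesOnBoundary_wedgeForm_left_zero {s l : ℕ} (h : 0 + s = l) {f : DForm n M 0}
    (hf : ∀ x ∈ (𝓡∂ n).boundary M, f x = 0) (β : DForm n M s) :
    VanishesOnBoundary (wedgeForm h f β) := by
  intro x hx v _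
  rw [wedgeForm, hf x hx, wedge_zero_left]
  exact zero_mul _

end Groups

section Cochains

variable {n : ℕ} [NeZero n] {M : Type*} [TopologicalSpace M]
  [ChartedSpace (EuclideanHalfSpace n) M] [IsManifold (𝓡∂ n) ∞ M]
  {G : Subgroup (DiffGroup n M)}

theorem isSmooth_actForm {l : ℕ} (g : G) {α : DForm n M l} (hα : IsSmooth α) :
    IsSmooth (actForm l g α) := isSmooth_pullback g.1.2.1 hα

theorem isSmooth_cupSeq {p r q t l : ℕ} (h : q + t = l) {a : (Fin p → G) → DForm n M q}
    {b : (Fin r → G) → DForm n M t} (ha : ∀ g, IsSmooth (a g)) (hb : ∀ g, IsSmooth (b g))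
    (s : ℕ → G) : IsSmooth (cupSeq h a b s) :=
  isSmooth_wedgeForm h (isSmooth_actForm _ (ha _)) (hb _)

theorem dForm_cupSeq {p r q t l : ℕ} (h : q + t = l) {a : (Fin p → G) → DForm n M q}
    {b : (Fin r → G) → DForm n M t} (ha : ∀ g, IsSmooth (a g)) (hb : ∀ g, IsSmooth (b g))
    (s : ℕ → G) :
    dForm (cupSeq h a b s) = cupSeq (by omega) (fun g => dForm (a g)) b s +
      (-1 : ℤ) ^ q • cupSeq (by omega) a (fun g => dForm (b g)) s := by
  have e : dForm (actForm q (seqProd (fun j => s (p + j)) r) (a fun j => s j)) =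
      actForm (q + 1) (seqProd (fun j => s (p + j)) r) (dForm (a fun j => s j)) :=
    dForm_pullback (seqProd (fun j => s (p + j)) r).1.2.1 (ha _)
  rw [cupSeq, dForm_wedgeForm h (isSmooth_actForm _ (ha _)) (hb _), e]
  rfl

variable [T2Space M] [CompactSpace M] {vol : DForm n M n}

/-- Integration over `M` commutes with `δ` for groups of volume-preserving diffeomorphisms. -/
theorem coboundarySeq_integral (hvol : IsVolumeForm vol)
    (hG : ∀ g : G, pullback (toMap (g : DiffGroup n M)) vol = vol) (k : ℕ)
    {C : (ℕ → G) → DForm n M n} (hC : ∀ s, IsSmooth (C s)) (s : ℕ → G) :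
    coboundarySeq (fun (_ : G) (x : ℝ) => x) k (fun s => integral vol (C s)) s =
      integral vol (coboundarySeq (actForm n) k C s) := by
  have h2 : IsSmooth (∑ i ∈ Finset.range k, (-1 : ℤ) ^ (i + 1) • C (contractSeq i s)) :=
    isSmooth_sum _ fun i _ => isSmooth_zsmul _ (hC _)
  have h3 : IsSmooth (actForm n (s k) (C s)) := isSmooth_actForm _ (hC s)
  rw [coboundarySeq, coboundarySeq, integral_add hvol (isSmooth_add (hC _) h2)
    (isSmooth_zsmul _ h3), integral_add hvol (hC _) h2,
    integral_sum hvol _ fun i _ => isSmooth_zsmul _ (hC _)]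
  simp only [integral_zsmul hvol]
  rw [integral_pullback hvol _ (hG (s k)) (hC s)]

end Cochains

/-! ### The primitive of `ω` and its square -/

section Main

variable {m : ℕ} [NeZero (m + 2)] {M : Type*} [TopologicalSpace M]
  [ChartedSpace (EuclideanHalfSpace (m + 2)) M]
  {vol : DForm (m + 2) M (m + 2)} {φ : FormCochains (DiffVolRel vol)}

/-- The component of bidegree `(m, m + 2)` of `φ ∧ φ`. -/
theorem cup_self_eq (hφ : IsPrimitive vol φ) (s : ℕ → DiffVolRel vol) :
    cup φ φ m (m + 2) (fun j : Fin m => s j) = ∑ p : Fin (m + 1),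
      cupSeq (show m - p + 1 + (p + 1) = m + 2 by omega) (φ p (m - p + 1))
        (φ (m - p) (p + 1)) s := by
  funext x
  rw [Finset.sum_apply]
  refine Finset.sum_congr rfl fun p _ => ?_
  have hz : ∀ q : Fin (m + 3), q ≠ ⟨m - p + 1, by omega⟩ → φ p q = 0 := fun q hq =>
    hφ.degree _ _ fun h => hq (Fin.ext (by simp at h ⊢; omega))
  rw [Finset.sum_eq_single (⟨m - p + 1, by omega⟩ : Fin (m + 3)) (fun q _ hq => ?_) (by simp)]
  · have key : ∀ t (h : m - p + 1 + t = m + 2), t = p + 1 →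
        wedge h (pullback (toMap ((List.ofFn fun j : Fin (m - p) => s (p + j)).prod :
            DiffVolRel vol).1) (φ p (m - p + 1) fun j => s j) x)
          (φ (m - p) t (fun j => s (p + j)) x) =
        cupSeq (show m - p + 1 + (p + 1) = m + 2 by omega) (φ p (m - p + 1))
          (φ (m - p) (p + 1)) s x := by
      rintro t h rfl
      rw [prod_ofFn_eq_seqProd (fun j => s (p + j)) (m - p)]
      rfl
    exact key _ _ (by simp; omega)
  · rw [hz q hq]
    have : ∀ {t : ℕ} (h : (q : ℕ) + t = m + 2) (β : (TangentSpace (𝓡∂ (m + 2)) x) [⋀^Fin t]→L[ℝ] ℝ),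
        wedge h (0 : (TangentSpace (𝓡∂ (m + 2)) x) [⋀^Fin q]→L[ℝ] ℝ) β = 0 := fun h β => by
      have := wedge_smul_left h 0 (0 : (TangentSpace (𝓡∂ (m + 2)) x) [⋀^Fin q]→L[ℝ] ℝ) β
      simpa using this
    exact this _ _

/-- The components of `dφ = ω^{(n)}` in positive cochain and form degrees. -/
theorem deltaForm_eq (hφ : IsPrimitive vol φ) (i j : ℕ) :
    deltaForm (φ i (j + 1)) = (-1 : ℤ) ^ i • fun g => dForm (φ (i + 1) j g) := by
  have h := congrFun (congrFun hφ.d_eq (i + 1)) (j + 1)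
  have h0 : omegaCochain (DiffVolRel vol) vol (i + 1) (j + 1) = 0 := by
    funext g
    simp [omegaCochain]
  rw [h0] at h
  have h1 : deltaForm (φ i (j + 1)) = - dSecond (φ (i + 1) j) := eq_neg_of_add_eq_zero_left h
  rw [h1]
  funext g
  simp only [Pi.neg_apply, Pi.smul_apply, dSecond, pow_succ, mul_neg, mul_one, neg_smul, neg_neg]

theorem deltaForm_eq_zero (hφ : IsPrimitive vol φ) : deltaForm (φ (m + 1) 0) = 0 := by
  have h := congrFun (congrFun hφ.d_eq (m + 2)) 0
  have h0 : omegaCochain (DiffVolRel vol) vol (m + 2) 0 = 0 := by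
    funext g
    simp [omegaCochain]
  exact h.trans h0

theorem dForm_eq_vol (hφ : IsPrimitive vol φ) (g : Fin 0 → DiffVolRel vol) :
    dForm (φ 0 (m + 1) g) = vol := by
  have h := congrFun (congrFun (congrFun hφ.d_eq 0) (m + 2)) g
  have h0 : omegaCochain (DiffVolRel vol) vol 0 (m + 2) g = vol := by
    simp [omegaCochain, castDegree]
  rw [h0] at h
  rw [← h]
  change _ = (-1 : ℤ) ^ 0 • dForm (φ 0 (m + 1) g)
  rw [pow_zero, one_smul]

/-- The form `φ^{(b)} ∧ φ^{(a)}` satisfies the boundary condition of Stokes' theorem. The only case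
in which the second factor need not vanish on `∂M` is `a = n - 1`, when the first factor is the
function `φ^{(0)}`. -/
theorem vanishesOnBoundary_cupSeq (hφ : IsPrimitive vol φ) {a b : ℕ} (hab : b + a = m + 1)
    (s : ℕ → DiffVolRel vol) : VanishesOnBoundary (cupSeq hab (φ a b) (φ b a) s) := by
  rcases Nat.lt_or_ge a (m + 1) with h | h
  · exact vanishesOnBoundary_wedgeForm_right _ _ (hφ.rel b a h _).2
  · obtain rfl : b = 0 := by omega
    obtain rfl : a = m + 1 := by omega
    refine vanishesOnBoundary_wedgeForm_left_zero _ (fun x hx => ?_) _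
    -- A boundary point is fixed by the group, and there `φ^{(0)}` vanishes.
    have h1 : ∀ y, y = x → formAt (φ (m + 1) 0 fun j => s j) y = 0 := by
      rintro y rfl
      ext v
      exact (hφ.rel (m + 1) 0 (by omega) _).2 y hx v fun i => i.elim0
    change (formAt (φ (m + 1) 0 fun j => s j) (toMap
      (seqProd (fun j => s (m + 1 + j)) 0 : DiffVolRel vol).1 x)).compContinuousLinearMap _ = 0
    rw [h1 _ (toMap_eq_of_mem_boundary _ hx)]
    rfl

variable [IsManifold (𝓡∂ (m + 2)) ∞ M] [T2Space M] [CompactSpace M]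

variable (vol φ) in
/-- `∫_M φ^{(b)} ∧ d φ^{(a)}` for `a + b = n - 1`, as a function of the elements of the group.
For other `a`, `b` this is not a top degree form, and the value is set to `0`. -/
noncomputable def pairing (s : ℕ → DiffVolRel vol) (a b : ℕ) : ℝ :=
  if h : b + (a + 1) = m + 2 then
    integral vol (cupSeq h (φ a b) (fun g => dForm (φ b a g)) s) else 0

/-- Integration by parts. -/
theorem integral_cupSeq_dForm (hvol : IsVolumeForm vol) (hφ : IsPrimitive vol φ) {a b : ℕ}
    (h : b + 1 + a = m + 2) (s : ℕ → DiffVolRel vol) :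
    integral vol (cupSeq h (fun g => dForm (φ a b g)) (φ b a) s) =
      -((-1 : ℤ) ^ b • pairing vol φ s a b) := by
  have hab : b + a = m + 1 := by omega
  have h' : b + (a + 1) = m + 2 := by omega
  have hs := hφ.smooth
  have h1 := integral_dForm hvol (isSmooth_cupSeq hab (hs a b) (hs b a) s)
    (vanishesOnBoundary_cupSeq hφ hab s)
  have s1 : IsSmooth (cupSeq h (fun g => dForm (φ a b g)) (φ b a) s) :=
    isSmooth_cupSeq h (fun g => isSmooth_dForm (hs a b g)) (hs b a) s
  have s2 : IsSmooth (cupSeq h' (φ a b) (fun g => dForm (φ b a g)) s) :=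
    isSmooth_cupSeq h' (hs a b) (fun g => isSmooth_dForm (hs b a g)) s
  rw [dForm_cupSeq hab (hs a b) (hs b a) s, integral_add hvol s1 (isSmooth_zsmul _ s2),
    integral_zsmul hvol] at h1
  rw [pairing, dif_pos h']
  linarith

/-- The coboundary of one summand of `∫_M φ ∧ φ` is a difference of consecutive pairings: apply the
Leibniz rule, replace `δφ^{(l + 1)}` by `±dφ^{(l)}` and integrate by parts. -/
theorem integral_coboundarySeq_cupSeq (hm : Odd m) (hvol : IsVolumeForm vol)
    (hφ : IsPrimitive vol φ) {i j : ℕ} (hij : i + j = m) (h : j + 1 + (i + 1) = m + 2)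
    (s : ℕ → DiffVolRel vol) :
    integral vol (coboundarySeq (actForm (m + 2)) m (cupSeq h (φ i (j + 1)) (φ j (i + 1))) s) =
      pairing vol φ s (i + 1) j - pairing vol φ s i (j + 1) := by
  have hs := hφ.smooth
  have h1 := coboundarySeq_cupSeq h (φ i (j + 1)) (φ j (i + 1)) s
  rw [deltaForm_eq hφ i j, deltaForm_eq hφ j i, cupSeq_zsmul_left, cupSeq_zsmul_right, hij,
    smul_smul, ← pow_add, hij, hm.neg_one_pow] at h1
  have s1 : IsSmooth (cupSeq h (fun g => dForm (φ (i + 1) j g)) (φ j (i + 1)) s) :=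
    isSmooth_cupSeq h (fun g => isSmooth_dForm (hs _ _ g)) (hs _ _) s
  have s2 : IsSmooth (cupSeq h (φ i (j + 1)) (fun g => dForm (φ (j + 1) i g)) s) :=
    isSmooth_cupSeq h (hs _ _) (fun g => isSmooth_dForm (hs _ _ g)) s
  rw [h1, integral_add hvol (isSmooth_zsmul _ s1) (isSmooth_zsmul _ s2), integral_zsmul hvol,
    integral_zsmul hvol, integral_cupSeq_dForm hvol hφ h, smul_neg, smul_smul, ← pow_add, hij,
    hm.neg_one_pow, pairing, pairing, dif_pos (show j + (i + 1 + 1) = m + 2 by omega), dif_pos h]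
  simp
  ring

theorem pairing_last (hφ : IsPrimitive vol φ) (s : ℕ → DiffVolRel vol) :
    pairing vol φ s (m + 1) 0 = cCochain vol φ (fun j : Fin (m + 1) => s j) := by
  have h : 0 + (m + 1 + 1) = m + 2 := by omega
  rw [pairing, dif_pos h, cCochain]
  congr 1
  have e : (fun g => dForm (φ 0 (m + 1) g)) = fun _ => vol := funext fun g => dForm_eq_vol hφ g
  rw [e]
  funext x
  rw [cupSeq, actForm, seqProd]
  change wedge h (pullback (toMap (1 : DiffGroup (m + 2) M)) _ x) (vol x) = _
  rw [pullback_one]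
  rfl

/-- At the other end of the telescoping sum, `∫_M φ^{(n-1)} ∧ dφ^{(0)} = -∫_M ω ∧ φ^{(0)}`, and `ω`
is invariant under the group. -/
theorem pairing_zero (hm : Odd m) (hvol : IsVolumeForm vol) (hφ : IsPrimitive vol φ)
    (s : ℕ → DiffVolRel vol) :
    pairing vol φ s 0 (m + 1) = - cCochain vol φ (fun j : Fin (m + 1) => s j) := by
  have h : m + 1 + 1 + 0 = m + 2 := by omega
  have h1 := integral_cupSeq_dForm hvol hφ h s
  rw [hm.add_one.neg_one_pow, one_smul] at h1
  rw [← neg_eq_iff_eq_neg, ← h1, cCochain]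
  congr 1
  have e : (fun g => dForm (φ 0 (m + 1) g)) = fun _ => vol := funext fun g => dForm_eq_vol hφ g
  rw [e]
  funext x
  have hs : (fun j => s (0 + j)) = s := by funext j; rw [zero_add]
  have hg : (fun j : Fin (m + 1) => s (0 + j)) = fun j : Fin (m + 1) => s j := by
    funext j; rw [zero_add]
  rw [cupSeq, actForm, pullback_vol, hg, wedgeForm, wedge_zero_right, wedge_zero_left]
  rfl

/-- A finite sequence, extended by `1`. -/
noncomputable def extendSeq {G : Type*} [Group G] {k : ℕ} (g : Fin k → G) : ℕ → G := fun j =>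
  if h : j < k then g ⟨j, h⟩ else 1

theorem extendSeq_apply {G : Type*} [Group G] {k : ℕ} (g : Fin k → G) :
    (fun j : Fin k => extendSeq g j) = g := by
  funext j
  simp [extendSeq]

/-- The coboundaries of the summands of `∫_M φ ∧ φ` telescope. -/
theorem cCochain_eq_realCoboundary (hm : Odd m) (hvol : IsVolumeForm vol)
    (hφ : IsPrimitive vol φ) :
    cCochain vol φ = realCoboundary (DiffVolRel vol) m
      (((1 / 2 : ℝ) • fibreIntegral vol (cup φ φ)) m) := by
  have hs := hφ.smooth
  rw [Pi.smul_apply, map_smul]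
  funext g
  rw [← extendSeq_apply g]
  set s := extendSeq g
  change _ = (1 / 2 : ℝ) * coboundary (fun _ r => r) (fibreIntegral vol (cup φ φ) m)
    (fun j : Fin (m + 1) => s j)
  rw [coboundary_eq_coboundarySeq]
  simp only [fibreIntegral]
  have e1 : (fun s : ℕ → DiffVolRel vol => integral vol (cup φ φ m (m + 2) fun j : Fin m => s j)) =
      fun s => ∑ p : Fin (m + 1), integral vol
        (cupSeq (show m - p + 1 + (p + 1) = m + 2 by omega) (φ p (m - p + 1))
        (φ (m - p) (p + 1)) s) := by
    funext s
    rw [cup_self_eq hφ, integral_sum hvol _ fun p _ => isSmooth_cupSeq _ (hs _ _) (hs _ _) s]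
  have e2 : ∀ (C : Fin (m + 1) → (ℕ → DiffVolRel vol) → ℝ),
      coboundarySeq (fun (_ : DiffVolRel vol) (x : ℝ) => x) m (fun s => ∑ p, C p s) s =
        ∑ p, coboundarySeq (fun (_ : DiffVolRel vol) (x : ℝ) => x) m (C p) s := fun C => by
    simp only [coboundarySeq, Finset.sum_add_distrib, Finset.smul_sum]
    rw [Finset.sum_comm]
  rw [e1, e2]
  have e3 : ∀ p : Fin (m + 1), coboundarySeq (fun (_ : DiffVolRel vol) (x : ℝ) => x) m
      (fun s => integral vol
        (cupSeq (show m - p + 1 + (p + 1) = m + 2 by omega) (φ p (m - p + 1))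
        (φ (m - p) (p + 1)) s)) s =
      pairing vol φ s (p + 1) (m + 1 - (p + 1)) - pairing vol φ s p (m + 1 - p) := fun p => by
    rw [coboundarySeq_integral hvol pullback_vol m
      (fun s => isSmooth_cupSeq _ (hs _ _) (hs _ _) s),
      integral_coboundarySeq_cupSeq hm hvol hφ (by omega)]
    congr 2 <;> omega
  rw [Finset.sum_congr rfl fun p _ => e3 p,
    Fin.sum_univ_eq_sum_range (fun p => pairing vol φ s (p + 1) (m + 1 - (p + 1)) -
      pairing vol φ s p (m + 1 - p)),
    Finset.sum_range_sub (fun p => pairing vol φ s p (m + 1 - p)), Nat.sub_self, Nat.sub_zero,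
    pairing_last hφ, pairing_zero hm hvol hφ]
  have hc : ∀ c : ℝ, c = 1 / 2 * (c - -c) := fun c => by ring
  exact hc _

/-- `∫_M φ^{(0)} ∧ ω` is a cocycle because `δφ^{(0)} = 0` and `ω` is invariant. -/
theorem realCoboundary_cCochain (hvol : IsVolumeForm vol) (hφ : IsPrimitive vol φ) :
    realCoboundary (DiffVolRel vol) (m + 1) (cCochain vol φ) = 0 := by
  have h : 0 + (m + 2) = m + 2 := by omega
  let b : (Fin 0 → DiffVolRel vol) → DForm (m + 2) M (m + 2) := fun _ => vol
  have hb : deltaForm b = 0 := by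
    funext g
    simp [deltaForm, coboundary, b, pullback_vol]
  have hs := hφ.smooth
  funext g
  rw [← extendSeq_apply g]
  set s := extendSeq g
  refine (coboundary_eq_coboundarySeq (k := m + 1) (fun _ r => r) (cCochain vol φ) s).trans ?_
  have e1 : (fun s : ℕ → DiffVolRel vol => cCochain vol φ fun j : Fin (m + 1) => s j) =
      fun s => integral vol (cupSeq h (φ (m + 1) 0) b s) := by
    funext s
    rw [cCochain]
    congr 1
    funext x
    rw [cupSeq, actForm, seqProd]
    change _ = wedge h (pullback (toMap (1 : DiffGroup (m + 2) M)) _ x) (vol x)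
    rw [pullback_one]
    rfl
  have e2 := coboundarySeq_cupSeq h (φ (m + 1) 0) b s
  have e3 := coboundarySeq_integral hvol pullback_vol (m + 1)
    (C := cupSeq h (φ (m + 1) 0) b)
    (fun s => isSmooth_cupSeq h (hs (m + 1) 0) (fun _ => hvol.1) s) s
  refine (congrArg (fun c => coboundarySeq (fun (_ : DiffVolRel vol) (x : ℝ) => x) (m + 1) c s)
    e1).trans (e3.trans ?_)
  rw [show m + 1 = m + 1 + 0 from rfl, e2, deltaForm_eq_zero hφ, hb]
  have z1 : cupSeq h (0 : (Fin (m + 2) → DiffVolRel vol) → DForm (m + 2) M 0) b s = 0 := by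
    simpa using cupSeq_zsmul_left h 0 (0 : (Fin (m + 2) → DiffVolRel vol) → DForm (m + 2) M 0) b s
  have z2 : cupSeq h (φ (m + 1) 0)
      (0 : (Fin 1 → DiffVolRel vol) → DForm (m + 2) M (m + 2)) s = 0 := by
    simpa using cupSeq_zsmul_right h 0 (φ (m + 1) 0)
      (0 : (Fin 1 → DiffVolRel vol) → DForm (m + 2) M (m + 2)) s
  rw [z1, z2, smul_zero, add_zero]
  simpa using integral_smul hvol 0 (0 : DForm (m + 2) M (m + 2))

end Main

end VolumeDiff

open VolumeDiff in
theorem proposition3p2 (n : ℕ) [NeZero n] (hn : Odd n) (hn1 : n ≠ 1)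
    (M : Type*) [TopologicalSpace M] [ChartedSpace (EuclideanHalfSpace n) M]
    [IsManifold (𝓡∂ n) ∞ M] [T2Space M] [CompactSpace M] [ConnectedSpace M]
    (vol : DForm n M n) (hvol : IsVolumeForm vol)
    (hrel : ∀ l < n, RelCohomologyVanishes n M l)
    (φ : FormCochains (DiffVolRel vol)) (hφ : IsPrimitive vol φ) :
    (∃ hz : cCochain vol φ ∈ realCocycles (DiffVolRel vol) (n - 1),
      cohomologyClass ⟨cCochain vol φ, hz⟩ = 0) ∧
    cCochain vol φ =
      realD (DiffVolRel vol) ((1 / 2 : ℝ) • fibreIntegral vol (cup φ φ)) (n - 1) := by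
  obtain ⟨m, rfl, hm⟩ : ∃ m, n = m + 2 ∧ Odd m := by
    obtain ⟨k, rfl⟩ := hn
    exact ⟨2 * k - 1, by omega, ⟨k - 1, by omega⟩⟩
  have hmain := cCochain_eq_realCoboundary hm hvol hφ
  refine ⟨⟨realCoboundary_cCochain hvol hφ, ?_⟩, hmain⟩
  exact (Submodule.Quotient.mk_eq_zero _).2 ⟨_, hmain.symm⟩
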